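/- Let $d\ge 1$ and consider Bernoulli site percolation on $\mathbb{Z}^d$: under $\mathbb{P}_p$ every site is occupied with probability $p$ and vacant with probability $1-p$, independently. The cluster $\mathcal{C}(x,\omega)$ of a site $x$ is the set of sites joined to $x$ by a nearest-neighbour path of occupied sites if $x$ is occupied, and is empty if $x$ is vacant. Let $p_c=p_c(d)$ be the supremum of all $p\in[0,1]$ for which there is $\mathbb{P}_p$-almost surely no infinite cluster. Let $B_n=[-n,n]^d\cap\mathbb{Z}^d$, let $\omega_{B_n}$ be the configuration that agrees with $\omega$ in $B_n$ and is vacant outside $B_n$, and let $$\mathcal{M}_n(\omega)=\max_x|\mathcal{C}_{\rm le}(x,\omega_{B_n})|,$$ where $\mathcal{C}_{\rm le}(x,\omega)=\mathcal{C}(x,\omega)$ if $x$ is the lexicographic minimum of $\mathcal{C}(x,\omega)$, and $\mathcal{C}_{\rm le}(x,\omega)=\emptyset$ otherwise (so $\mathcal{M}_n$ is the size of the largest cluster in $B_n$ with zero boundary conditions). **Theorem 1.3.** Let $0<p<p_c$. Then the limit $$\zeta(p,d)=\lim_{n\to\infty}-\frac1n\log\mathbb{P}_p\big(|\mathcal{C}(0)|\ge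 n\big)$$ exists and satisfies $0<\zeta(p,d)<\infty$, and $$\frac{\mathcal{M}_n}{\log n}\longrightarrow\frac{d}{\zeta(p,d)}\qquad \mathbb{P}_p\text{-almost surely as } n\to\infty.$$ -/

import Mathlib

open MeasureTheory ProbabilityTheory Filter Topology

noncomputable section

namespace SitePercolation

/-- The sites of the lattice `ℤ^d`. -/
abbrev Site (d : ℕ) : Type := Fin d → ℤ

/-- A configuration of occupied (`true`) and vacant (`false`) sites. -/
abbrev Config (d : ℕ) : Type := Site d → Bool

/-- The nearest-neighbour graph on the occupied sites of `ω`: two occupied sites are joined when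
their `ℓ¹`-distance is `1`. -/
def occupiedGraph {d : ℕ} (ω : Config d) : SimpleGraph (Site d) where
  Adj x y := ω x = true ∧ ω y = true ∧ ∑ i, |x i - y i| = 1
  symm := ⟨fun x y h => ⟨h.2.1, h.1, by simpa only [abs_sub_comm] using h.2.2⟩⟩
  loopless := ⟨fun x h => by simpa using h.2.2⟩

/-- The cluster `C(x, ω)`: all sites joined to the occupied site `x` by a nearest-neighbour path of
occupied sites; it is empty when `x` is vacant. -/
def cluster {d : ℕ} (ω : Config d) (x : Site d) : Set (Site d) :=
  {y | ω x = true ∧ (occupiedGraph ω).Reachable x y}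

/-- `x` is the left endpoint of `A`, its minimum in the lexicographic order. -/
def IsLeftEndpoint {d : ℕ} (A : Set (Site d)) (x : Site d) : Prop :=
  x ∈ A ∧ ∀ y ∈ A, toLex x ≤ toLex y

/-- The cluster of `x` if `x` is its left endpoint, and the empty set otherwise. -/
def clusterLE {d : ℕ} (ω : Config d) (x : Site d) : Set (Site d) :=
  {y | IsLeftEndpoint (cluster ω x) x ∧ y ∈ cluster ω x}

/-- The box `B_n = [-n, n]^d ∩ ℤ^d`. -/
def box (d n : ℕ) : Set (Site d) := {x | ∀ i, |x i| ≤ (n : ℤ)}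

open Classical in
/-- The configuration that agrees with `ω` in `B_n` and is vacant outside `B_n`. -/
def restrictBox {d : ℕ} (n : ℕ) (ω : Config d) : Config d :=
  fun x => if x ∈ box d n then ω x else false

/-- The size of the largest cluster in `B_n` with zero boundary condition. The supremum is over a
bounded family, see `bddAbove_clusterLE`. -/
def maxCluster {d : ℕ} (n : ℕ) (ω : Config d) : ℕ :=
  ⨆ x : Site d, (clusterLE (restrictBox n ω) x).ncard

/-- The law of Bernoulli site percolation on `ℤ^d`: sites are independently occupied with
probability `p` and vacant with probability `1 - p`. -/
def bernoulliSite (d : ℕ) (p : unitInterval) : Measure (Config d) :=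
  Measure.infinitePi fun _ : Site d => bernoulliMeasure true false p

/-- The critical value: the supremum of all `p ∈ [0, 1]` for which almost surely there is no
infinite cluster. -/
def criticalValue (d : ℕ) : ℝ :=
  sSup {q : ℝ | ∃ p : unitInterval, (p : ℝ) = q ∧
    ∀ᵐ ω ∂(bernoulliSite d p), ∀ x, (cluster ω x).Finite}

/-- The probability `P_p(|C(0)| ≥ n)`; infinite clusters count. -/
def clusterTail (d : ℕ) (p : unitInterval) (n : ℕ) : ℝ :=
  (bernoulliSite d p).real {ω | (n : ℕ∞) ≤ (cluster ω (0 : Site d)).encard}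

theorem box_finite (d n : ℕ) : (box d n).Finite := by
  refine (Set.finite_Icc (fun _ : Fin d => -(n : ℤ)) (fun _ => (n : ℤ))).subset ?_
  intro x hx
  exact ⟨fun i => (abs_le.mp (hx i)).1, fun i => (abs_le.mp (hx i)).2⟩

theorem occupied_of_mem_cluster {d : ℕ} {ω : Config d} {x y : Site d} (h : y ∈ cluster ω x) :
    ω y = true := by
  obtain ⟨hx, ⟨w⟩⟩ := h
  induction w with
  | nil => exact hx
  | cons h _ ih => exact ih h.2.1

theorem bddAbove_clusterLE {d : ℕ} (n : ℕ) (ω : Config d) :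
    BddAbove (Set.range fun x : Site d => (clusterLE (restrictBox n ω) x).ncard) := by
  refine ⟨(box d n).ncard, ?_⟩
  rintro _ ⟨x, rfl⟩
  refine Set.ncard_le_ncard (fun y hy => ?_) (box_finite d n)
  have h := occupied_of_mem_cluster hy.2
  by_contra hb
  simp [restrictBox, hb] at h

end SitePercolation

end

/-! The rate exists by supermultiplicativity. Let κ_n be the probability that the origin is the
lexicographic minimum of a connected occupied set of n sites. Such a set ending at its maximum y can
be prolonged by one starting at a neighbour of y above y. The two halves use disjoint sites, so κ_m
κ_n ≤ κ_{m+n} (`leftEvent_mul_le`), and Fekete's lemma applies to -log κ_n. Since κ_n ≤ P(|C(0)| ≥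
n) ≤ (2n+1)^d κ_n, the cluster tail has the same rate.

Positivity of the rate is exponential decay below p_c. Choose p' > p with no infinite cluster at p'.
Tilt the law of the cluster at p' by exp(-h|C|). Exploring the cluster site by site, the tilt lowers
the chance that the next site is occupied, but by Harris' inequality only by a factor bounded below,
and this factor is near 1 for small h, up to P_{p'}(|C| ≥ k)/p' with k fixed and large. Hence the
tilted law still dominates the law at p (`bernSum_mul_reachLaplace_le`), and under the tilted law
large clusters are exponentially rare (`exists_clusterTail_le_exp`).

For the largest cluster, a union bound over the box gives the upper estimate, and independence over
disjoint balls gives the lower one. At n = 2^j both error probabilities are summable, so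
Borel–Cantelli applies. Monotonicity of the maximum in n fills the gaps between powers of 2. -/

namespace SitePercolation

/-! ### Paths through a set of sites -/

/-- Two sites are neighbours when their `ℓ¹`-distance is `1`. -/
def Nbr {d : ℕ} (x y : Site d) : Prop := ∑ i, |x i - y i| = 1

theorem Nbr.symm {d : ℕ} {x y : Site d} (h : Nbr x y) : Nbr y x := by
  simpa only [Nbr, abs_sub_comm] using h

theorem Nbr.abs_le {d : ℕ} {x y : Site d} (h : Nbr x y) (i : Fin d) : |x i - y i| ≤ 1 := by
  have := Finset.single_le_sum (f := fun i => |x i - y i|) (fun j _ => abs_nonneg _)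
    (Finset.mem_univ i)
  exact this.trans h.le

theorem Nbr.add_right {d : ℕ} {x y : Site d} (h : Nbr x y) (a : Site d) : Nbr (x + a) (y + a) := by
  simpa [Nbr] using h

theorem nbr_add_single {d : ℕ} (x : Site d) (i : Fin d) : Nbr x (x + Pi.single i 1) := by
  simp only [Nbr, Pi.add_apply, sub_add_cancel_left, abs_neg]
  rw [Finset.sum_eq_single i]
  · simp
  · intro j _ hj
    simp [hj]
  · simp

/-- The sites reached from `A` by nearest-neighbour paths whose later sites lie in `T`. -/
inductive Reach {d : ℕ} (A T : Set (Site d)) : Site d → Prop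
  | base {x : Site d} : x ∈ A → Reach A T x
  | step {x y : Site d} : Reach A T x → Nbr x y → y ∈ T → Reach A T y

section Reach

variable {d : ℕ} {A A' B T T' : Set (Site d)} {x y : Site d}

theorem Reach.mono (hA : A ⊆ A') (hT : T ⊆ T') (h : Reach A T y) : Reach A' T' y := by
  induction h with
  | base h => exact .base (hA h)
  | step _ hn hy ih => exact .step ih hn (hT hy)

theorem Reach.of_union (h : Reach (A ∪ B) T y) : Reach A T y ∨ Reach B T y := by
  induction h with
  | base h => exact h.imp .base .base
  | step _ hn hy ih => exact ih.imp (fun h => .step h hn hy) (fun h => .step h hn hy)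

theorem Reach.mem_union (h : Reach A T y) : y ∈ A ∪ T := by
  cases h with
  | base h => exact Or.inl h
  | step _ _ hy => exact Or.inr hy

theorem Reach.mem_of_not_nbr (hT : ∀ x ∈ A, ∀ y ∈ T, ¬ Nbr x y) (h : Reach A T y) : y ∈ A := by
  induction h with
  | base h => exact h
  | step _ hn hy ih => exact absurd hn (hT _ ih _ hy)

theorem Reach.of_insert (hx : x ∈ A) (h : Reach A (insert x T) y) : Reach A T y := by
  induction h with
  | base h => exact .base h
  | step _ hn hy ih =>
    rcases hy with rfl | hy
    · exact .base hx
    · exact .step ih hn hy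

/-- One exploration step: a site adjacent to the explored set, once found open, may be counted as
explored. This drives the induction in the comparison of densities. -/
theorem reach_insert_iff {a : Site d} (ha : a ∈ A) (hx : Nbr a x) :
    Reach A (insert x T) y ↔ Reach (insert x A) T y := by
  constructor
  · intro h
    induction h with
    | base h => exact .base (Or.inr h)
    | step _ hn hy ih =>
      rcases hy with rfl | hy
      · exact .base (Or.inl rfl)
      · exact .step ih hn hy
  · intro h
    induction h with
    | base h =>
      rcases h with rfl | h
      · exact .step (.base ha) hx (Or.inl rfl)
      · exact .base h
    | step _ hn hy ih => exact .step ih hn (Or.inr hy)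

end Reach

theorem mem_cluster_iff {d : ℕ} {ω : Config d} {x y : Site d} :
    y ∈ cluster ω x ↔ ω x = true ∧ Reach {x} {z | ω z = true} y := by
  constructor
  · rintro ⟨hx, h⟩
    refine ⟨hx, ?_⟩
    rw [SimpleGraph.reachable_iff_reflTransGen] at h
    induction h with
    | refl => exact .base rfl
    | tail _ h ih => exact .step ih h.2.2 h.2.1
  · rintro ⟨hx, h⟩
    have : ∀ y, Reach {x} {z | ω z = true} y → ω y = true := by
      intro y h
      rcases h.mem_union with rfl | h
      exacts [hx, h]
    refine ⟨hx, ?_⟩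
    induction h with
    | base h => rw [h]
    | step h hn hy ih => exact ih.trans (SimpleGraph.Adj.reachable ⟨this _ h, hy, hn⟩)

/-! ### Lattice animals and cluster sizes -/

/-- A finite connected set of sites (lattice animal) grown from the root `x`. -/
inductive Animal {d : ℕ} (x : Site d) : Finset (Site d) → Prop
  | single : Animal x {x}
  | grow {S : Finset (Site d)} {y z : Site d} :
      Animal x S → y ∈ S → Nbr y z → z ∉ S → Animal x (insert z S)

section Animal

variable {d : ℕ} {x y : Site d} {S S' : Finset (Site d)}

theorem Animal.root_mem (h : Animal x S) : x ∈ S := by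
  induction h with
  | single => simp
  | grow _ _ _ _ ih => simp [ih]

theorem Animal.card_pos (h : Animal x S) : 0 < S.card := Finset.card_pos.2 ⟨x, h.root_mem⟩

theorem Animal.reach {A T : Set (Site d)} (h : Animal x S) (hA : x ∈ A)
    (hT : ∀ y ∈ S, y ∈ T) : ∀ y ∈ S, Reach A T y := by
  induction h with
  | single =>
    intro y hy
    rw [Finset.mem_singleton.1 hy]
    exact .base hA
  | grow _ hz hn _ ih =>
    have ih := ih fun y hy => hT y (Finset.mem_insert_of_mem hy)
    intro y hy
    rcases Finset.mem_insert.1 hy with rfl | hy'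
    · exact .step (ih _ hz) hn (hT _ hy)
    · exact ih y hy'

theorem Animal.union (h : Animal x S) (h' : Animal y S') {z : Site d} (hz : z ∈ S) (hn : Nbr z y)
    (hd : Disjoint S S') : Animal x (S ∪ S') := by
  induction h' with
  | single =>
    rw [Finset.union_comm, ← Finset.insert_eq]
    exact .grow h hz hn (Finset.disjoint_singleton_right.1 hd)
  | grow _ hy hn' hz' ih =>
    rw [Finset.disjoint_insert_right] at hd
    rw [Finset.union_insert]
    exact .grow (ih hd.2) (Finset.mem_union_right _ hy) hn' (by simp [hd.1, hz'])

/-- The root is only bookkeeping. When the new root is the site added last, the old animal is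
rerooted at its attaching neighbour and glued to the singleton. -/
theorem Animal.reroot (h : Animal x S) : ∀ y ∈ S, Animal y S := by
  induction h with
  | single =>
    intro y hy
    rw [Finset.mem_singleton.1 hy]
    exact .single
  | @grow S w z _ hw hn hz ih =>
    intro y hy
    rcases Finset.mem_insert.1 hy with rfl | hy'
    · rw [Finset.insert_eq]
      exact Animal.single.union (ih w hw) (Finset.mem_singleton_self y) hn.symm
        (Finset.disjoint_singleton_left.2 hz)
    · exact .grow (ih y hy') hw hn hz

theorem Animal.map_add (h : Animal x S) (a : Site d) :
    Animal (x + a) (S.map (addRightEmbedding a)) := by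
  induction h with
  | single => exact .single
  | grow _ hy hn hz ih =>
    rw [Finset.map_insert]
    exact .grow ih (Finset.mem_map_of_mem _ hy) (hn.add_right a) (by simpa using hz)

theorem Animal.abs_sub_lt (h : Animal x S) : ∀ y ∈ S, ∀ i, |y i - x i| < S.card := by
  induction h with
  | single => simp
  | @grow S w z _ hw hn hz ih =>
    intro y hy i
    rw [Finset.card_insert_of_notMem hz]
    push_cast
    rcases Finset.mem_insert.1 hy with rfl | hy'
    · have h1 := ih w hw i
      have h2 := hn.abs_le i
      rw [abs_lt] at *
      rw [abs_le] at *
      constructor <;> linarith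
    · have h1 := ih y hy' i
      linarith

theorem exists_animal {T : Set (Site d)} {n : ℕ}
    (hn : ((n + 1 : ℕ) : ℕ∞) ≤ {y | Reach {x} T y}.encard) :
    ∃ S, Animal x S ∧ S.card = n + 1 ∧ ∀ y ∈ S, Reach {x} T y := by
  induction n with
  | zero =>
    exact ⟨{x}, .single, by simp, fun y hy => .base (Finset.mem_singleton.1 hy)⟩
  | succ n ih =>
    obtain ⟨S, hS, hc, hr⟩ := ih (le_trans (by exact_mod_cast Nat.le_succ _) hn)
    have hex : ∃ y, Reach {x} T y ∧ y ∉ S := by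
      by_contra hcon
      push Not at hcon
      have h1 : {y | Reach {x} T y}.encard ≤ (S : Set (Site d)).encard :=
        Set.encard_le_encard hcon
      rw [Set.encard_coe_eq_coe_finsetCard, hc] at h1
      have := hn.trans h1
      norm_cast at this
      omega
    obtain ⟨y, hy, hyS⟩ := hex
    -- A path from the root to a site outside `S` must leave `S` somewhere; the exit step supplies
    -- the site to add.
    have key : ∃ w ∈ S, ∃ z, z ∉ S ∧ Nbr w z ∧ z ∈ T := by
      induction hy with
      | base h =>
        rw [Set.mem_singleton_iff.1 h] at hyS
        exact absurd hS.root_mem hyS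
      | @step u v hu hnb hv ih' =>
        by_cases huS : u ∈ S
        · exact ⟨u, huS, v, hyS, hnb, hv⟩
        · exact ih' huS
    obtain ⟨w, hw, z, hz, hnb, hzT⟩ := key
    refine ⟨insert z S, .grow hS hw hnb hz, by rw [Finset.card_insert_of_notMem hz, hc], ?_⟩
    intro y hy
    rcases Finset.mem_insert.1 hy with rfl | hy
    · exact .step (hr w hw) hnb hzT
    · exact hr y hy

end Animal

/-- The event that `x` lies in a connected set of `n` occupied sites. -/
def animalEvent {d : ℕ} (x : Site d) (n : ℕ) : Set (Config d) :=
  {ω | ∃ S, Animal x S ∧ S.card = n ∧ ∀ y ∈ S, ω y = true}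

theorem Animal.subset_cluster {d : ℕ} {ω : Config d} {x : Site d} {S : Finset (Site d)}
    (h : Animal x S) (hS : ∀ y ∈ S, ω y = true) : (S : Set (Site d)) ⊆ cluster ω x := fun y hy =>
  mem_cluster_iff.2 ⟨hS x h.root_mem, h.reach (Set.mem_singleton x) hS y hy⟩

theorem exists_animal_of_le_encard_cluster {d : ℕ} {ω : Config d} {x : Site d} {n : ℕ}
    (hn : n ≠ 0) (h : (n : ℕ∞) ≤ (cluster ω x).encard) :
    ∃ S, Animal x S ∧ S.card = n ∧ (S : Set (Site d)) ⊆ cluster ω x := by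
  have hne : (cluster ω x).Nonempty := by
    rw [← Set.encard_pos]
    exact lt_of_lt_of_le (by exact_mod_cast Nat.pos_of_ne_zero hn) h
  have hx : ω x = true := hne.some_mem.1
  have heq : cluster ω x = {y | Reach {x} {z | ω z = true} y} := by
    ext y
    simp [mem_cluster_iff, hx]
  obtain ⟨n, rfl⟩ := Nat.exists_eq_succ_of_ne_zero hn
  rw [heq] at h ⊢
  exact exists_animal h

/-- Replaces a global size condition, infinite clusters included, by one that only a finite ball
decides. The case `n = 0` is excluded because animals are nonempty. -/
theorem le_encard_cluster_iff {d : ℕ} {ω : Config d} {x : Site d} {n : ℕ} (hn : n ≠ 0) :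
    (n : ℕ∞) ≤ (cluster ω x).encard ↔ ω ∈ animalEvent x n := by
  constructor
  · intro h
    obtain ⟨S, hS, hc, hsub⟩ := exists_animal_of_le_encard_cluster hn h
    exact ⟨S, hS, hc, fun y hy => occupied_of_mem_cluster (hsub hy)⟩
  · rintro ⟨S, hS, rfl, ho⟩
    rw [← Set.encard_coe_eq_coe_finsetCard]
    exact Set.encard_le_encard (hS.subset_cluster ho)

theorem cluster_finite_of_finite {d : ℕ} {ω : Config d} (h : {x | ω x = true}.Finite)
    (x : Site d) : (cluster ω x).Finite :=
  h.subset fun _ hy => occupied_of_mem_cluster hy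

theorem cluster_eq_of_mem {d : ℕ} {ω : Config d} {x y : Site d} (h : y ∈ cluster ω x) :
    cluster ω y = cluster ω x := by
  ext z
  exact ⟨fun hz => ⟨h.1, h.2.trans hz.2⟩, fun hz => ⟨occupied_of_mem_cluster h, h.2.symm.trans hz.2⟩⟩

theorem restrictBox_eq_true {d n : ℕ} {ω : Config d} {x : Site d} :
    restrictBox n ω x = true ↔ x ∈ box d n ∧ ω x = true := by
  simp [restrictBox]

/-- Left endpoints only select one representative per cluster: in the box every cluster is finite,
so it has a lexicographic minimum and is counted there in full. -/
theorem le_maxCluster_iff {d n k : ℕ} (hk : k ≠ 0) {ω : Config d} :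
    k ≤ maxCluster n ω ↔ ∃ x S, Animal x S ∧ S.card = k ∧ ∀ y ∈ S, y ∈ box d n ∧ ω y = true := by
  have hfin : ∀ x, (cluster (restrictBox n ω) x).Finite := fun x =>
    cluster_finite_of_finite ((box_finite d n).subset fun y hy => (restrictBox_eq_true.1 hy).1) x
  constructor
  · intro h
    obtain ⟨x, hx⟩ := Nat.sSup_mem (Set.range_nonempty _) (bddAbove_clusterLE n ω)
    replace hx : (clusterLE (restrictBox n ω) x).ncard = maxCluster n ω := hx
    have hle : k ≤ (cluster (restrictBox n ω) x).ncard :=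
      (h.trans hx.ge).trans (Set.ncard_le_ncard (fun y hy => hy.2) (hfin x))
    have hle' : (k : ℕ∞) ≤ (cluster (restrictBox n ω) x).encard := by
      rw [← (hfin x).cast_ncard_eq]
      exact_mod_cast hle
    obtain ⟨S, hS, hc, ho⟩ := (le_encard_cluster_iff hk).1 hle'
    exact ⟨x, S, hS, hc, fun y hy => restrictBox_eq_true.1 (ho y hy)⟩
  · rintro ⟨x, S, hS, rfl, hy⟩
    have hsub : (S : Set (Site d)) ⊆ cluster (restrictBox n ω) x :=
      hS.subset_cluster fun y h => restrictBox_eq_true.2 (hy y h)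
    obtain ⟨z, hz, hmin⟩ := Set.exists_min_image (cluster (restrictBox n ω) x) toLex (hfin x)
      ⟨x, hsub hS.root_mem⟩
    have heq := cluster_eq_of_mem hz
    have : clusterLE (restrictBox n ω) z = cluster (restrictBox n ω) x := by
      ext y
      simp only [clusterLE, IsLeftEndpoint, heq, Set.mem_ofPred_eq]
      exact ⟨fun h => h.2, fun h => ⟨⟨hz, hmin⟩, h⟩⟩
    refine le_trans ?_ (le_ciSup (bddAbove_clusterLE n ω) z)
    simp only [this]
    rw [← Set.ncard_coe_finset]
    exact Set.ncard_le_ncard hsub (hfin x)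

theorem maxCluster_mono {d : ℕ} (ω : Config d) : Monotone fun n => maxCluster n ω := by
  intro m n hmn
  by_cases h0 : maxCluster m ω = 0
  · simp [h0]
  · obtain ⟨x, S, hS, hc, hy⟩ := (le_maxCluster_iff h0).1 le_rfl
    refine (le_maxCluster_iff h0).2 ⟨x, S, hS, hc, fun y h => ⟨fun i => ?_, (hy y h).2⟩⟩
    exact ((hy y h).1 i).trans (by exact_mod_cast hmn)

/-! ### Local events: independence, translation, finite sums -/

/-- The event `E` is determined by the states of the sites in the finite set `V`. -/
def EventOn {d : ℕ} (E : Set (Config d)) (V : Finset (Site d)) : Prop :=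
  ∀ ω ω' : Config d, (∀ x ∈ V, ω x = ω' x) → ω ∈ E → ω' ∈ E

section EventOn

variable {d : ℕ} {E F : Set (Config d)} {V W : Finset (Site d)} {p : unitInterval}

instance (d : ℕ) (p : unitInterval) : IsProbabilityMeasure (bernoulliSite d p) := by
  unfold bernoulliSite
  infer_instance

theorem EventOn.mono (h : EventOn E V) (hVW : V ⊆ W) : EventOn E W :=
  fun ω ω' hw => h ω ω' fun x hx => hw x (hVW hx)

theorem EventOn.compl (h : EventOn E V) : EventOn Eᶜ V :=
  fun ω ω' hw hE hE' => hE (h ω' ω (fun x hx => (hw x hx).symm) hE')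

theorem EventOn.diff (h : EventOn E V) (h' : EventOn F V) : EventOn (E \ F) V :=
  fun ω ω' hw hE => ⟨h ω ω' hw hE.1, h'.compl ω ω' hw hE.2⟩

theorem EventOn.biUnion {ι : Type*} {s : Finset ι} {E : ι → Set (Config d)}
    (h : ∀ i ∈ s, EventOn (E i) V) : EventOn (⋃ i ∈ s, E i) V := by
  intro ω ω' hw hE
  simp only [Set.mem_iUnion] at hE ⊢
  obtain ⟨i, hi, hE⟩ := hE
  exact ⟨i, hi, h i hi ω ω' hw hE⟩

theorem EventOn.biInter {ι : Type*} {s : Finset ι} {E : ι → Set (Config d)}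
    (h : ∀ i ∈ s, EventOn (E i) V) : EventOn (⋂ i ∈ s, E i) V := by
  intro ω ω' hw hE
  simp only [Set.mem_iInter] at hE ⊢
  exact fun i hi => h i hi ω ω' hw (hE i hi)

theorem EventOn.eq_preimage (h : EventOn E V) :
    E = (fun ω (i : V) => ω i) ⁻¹' ((fun ω (i : V) => ω i) '' E) := by
  refine (Set.subset_preimage_image _ _).antisymm ?_
  rintro ω ⟨ω', hE, hw⟩
  exact h ω' ω (fun x hx => congrFun hw ⟨x, hx⟩) hE

theorem EventOn.measurableSet (h : EventOn E V) : MeasurableSet E := by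
  rw [h.eq_preimage]
  exact (measurable_pi_lambda _ fun i => measurable_pi_apply _) (Set.toFinite _).measurableSet

theorem EventOn.measure_inter (hE : EventOn E V) (hF : EventOn F W) (hVW : Disjoint V W) :
    (bernoulliSite d p).real (E ∩ F) =
      (bernoulliSite d p).real E * (bernoulliSite d p).real F := by
  have hind : iIndepFun (fun (x : Site d) (ω : Config d) => ω x) (bernoulliSite d p) :=
    iIndepFun_infinitePi (P := fun _ : Site d => bernoulliMeasure true false p)
      (X := fun _ b => b) (fun _ => measurable_id)
  have h := hind.indepFun_finset V W hVW fun x => measurable_pi_apply x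
  have := h.measure_inter_preimage_eq_mul _ _ (Set.toFinite ((fun ω (i : V) => ω i) '' E)).measurableSet
    (Set.toFinite ((fun ω (i : W) => ω i) '' F)).measurableSet
  rw [← hE.eq_preimage, ← hF.eq_preimage] at this
  simp only [Measure.real, this, ENNReal.toReal_mul]

theorem measure_biInter_compl {ι : Type*} {s : Finset ι} {E : ι → Set (Config d)}
    {V : ι → Finset (Site d)} (h : ∀ i ∈ s, EventOn (E i) (V i))
    (hV : (s : Set ι).PairwiseDisjoint V) :
    (bernoulliSite d p).real (⋂ i ∈ s, (E i)ᶜ) =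
      ∏ i ∈ s, (1 - (bernoulliSite d p).real (E i)) := by
  classical
  induction s using Finset.induction_on with
  | empty => simp
  | insert a s ha ih =>
    rw [Finset.set_biInter_insert, Finset.prod_insert ha, ← ih
      (fun i hi => h i (Finset.mem_insert_of_mem hi)) (hV.subset (by simp)),
      ← probReal_compl_eq_one_sub (h a (by simp)).measurableSet]
    refine (h a (by simp)).compl.measure_inter (W := s.biUnion V) ?_ ?_
    · exact EventOn.biInter fun i hi => ((h i (Finset.mem_insert_of_mem hi)).compl).mono
        (Finset.subset_biUnion_of_mem V hi)
    · rw [Finset.disjoint_biUnion_right]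
      intro i hi
      exact hV (by simp) (by simp [hi]) (fun hai => ha (hai ▸ hi))

theorem measurePreserving_shift (p : unitInterval) (a : Site d) :
    MeasurePreserving (fun (ω : Config d) x => ω (x + a)) (bernoulliSite d p)
      (bernoulliSite d p) := by
  have hm : Measurable (fun (ω : Config d) x => ω (x + a)) :=
    measurable_pi_lambda _ fun i => measurable_pi_apply _
  refine ⟨hm, Measure.eq_infinitePi _ fun s t ht => ?_⟩
  rw [Measure.map_apply hm (MeasurableSet.pi s.countable_toSet fun i _ => ht i)]
  have : (fun (ω : Config d) x => ω (x + a)) ⁻¹' ((s : Set (Site d)).pi t) =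
      ((s.map (addRightEmbedding a) : Finset (Site d)) : Set (Site d)).pi fun x => t (x - a) := by
    ext ω
    simp only [Set.mem_preimage, Set.mem_pi, Finset.coe_map, Set.forall_mem_image,
      addRightEmbedding_apply, add_sub_cancel_right]
  rw [this, bernoulliSite, Measure.infinitePi_pi _ (fun i _ => ht _)]
  simp

theorem EventOn.measure_shift (hE : EventOn E V) (p : unitInterval) (a : Site d) :
    (bernoulliSite d p).real {ω | (fun x => ω (x + a)) ∈ E} = (bernoulliSite d p).real E :=
  congrArg ENNReal.toReal
    ((measurePreserving_shift p a).measure_preimage hE.measurableSet.nullMeasurableSet)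

/-- The expectation of `g` of a random subset of `V` that contains each point independently with
probability `p`. -/
def bernSum {α : Type*} [DecidableEq α] (p : ℝ) (V : Finset α) (g : Finset α → ℝ) : ℝ :=
  ∑ T ∈ V.powerset, p ^ T.card * (1 - p) ^ (V \ T).card * g T

/-- The configuration whose occupied sites are the elements of `T`. -/
def occ (T : Finset (Site d)) : Config d := fun x => decide (x ∈ T)

-- Passes from the product measure to a finite sum over occupied subsets, where one can induct on
-- the number of sites.
open Classical in
theorem EventOn.measure_eq (hE : EventOn E V) :
    (bernoulliSite d p).real E = bernSum (p : ℝ) V fun T => if occ T ∈ E then 1 else 0 := by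
  have hdec : E = ⋃ T ∈ V.powerset.filter (fun T => occ T ∈ E),
      (V : Set (Site d)).pi fun x => {occ T x} := by
    ext ω
    simp only [Set.mem_iUnion, Finset.mem_filter, Finset.mem_powerset, Set.mem_pi,
      Set.mem_singleton_iff, exists_prop, Finset.mem_coe]
    constructor
    · intro h
      have : ∀ x ∈ V, ω x = occ (V.filter fun x => ω x = true) x := by
        intro x hx
        simp [occ, hx]
      exact ⟨V.filter fun x => ω x = true, ⟨Finset.filter_subset _ _, hE _ _ this h⟩, this⟩
    · rintro ⟨T, ⟨-, hT⟩, h⟩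
      exact hE _ _ (fun x hx => (h x hx).symm) hT
  have hdis : Set.PairwiseDisjoint (V.powerset.filter (fun T => occ T ∈ E) : Set (Finset (Site d)))
      fun T => (V : Set (Site d)).pi fun x => {occ T x} := by
    intro T hT T' hT' hne
    rw [Function.onFun, Set.disjoint_left]
    intro ω h h'
    refine hne ?_
    have hT := (Finset.mem_powerset.1 (Finset.mem_filter.1 hT).1)
    have hT' := (Finset.mem_powerset.1 (Finset.mem_filter.1 hT').1)
    ext x
    by_cases hx : x ∈ V
    · have := (h x hx).symm.trans (h' x hx)
      simpa [occ] using this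
    · exact ⟨fun h => absurd (hT h) hx, fun h => absurd (hT' h) hx⟩
  rw [congrArg (bernoulliSite d p).real hdec, measureReal_biUnion_finset hdis
    (fun T _ => MeasurableSet.pi V.countable_toSet fun i _ => measurableSet_singleton _)]
  rw [Finset.sum_filter, bernSum]
  have hval : ∀ T ∈ V.powerset, (bernoulliSite d p).real ((V : Set (Site d)).pi fun x => {occ T x})
      = (p : ℝ) ^ T.card * (1 - (p : ℝ)) ^ (V \ T).card := by
    intro T hT
    rw [Measure.real, bernoulliSite, Measure.infinitePi_pi _ (fun i _ => measurableSet_singleton _),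
      ENNReal.toReal_prod, ← Finset.prod_sdiff (Finset.mem_powerset.1 hT), mul_comm]
    congr 1
    · rw [Finset.prod_congr rfl (g := fun _ => (p : ℝ)), Finset.prod_const]
      intro x hx
      rw [← measureReal_def, bernoulliMeasure_real_apply _ (measurableSet_singleton _)]
      simp [occ, hx]
    · rw [Finset.prod_congr rfl (g := fun _ => 1 - (p : ℝ)), Finset.prod_const]
      intro x hx
      rw [← measureReal_def, bernoulliMeasure_real_apply _ (measurableSet_singleton _)]
      simp [occ, (Finset.mem_sdiff.1 hx).2]
  refine Finset.sum_congr rfl fun T hT => ?_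
  rw [hval T hT]
  split_ifs <;> simp

end EventOn

/-! ### Finite Bernoulli expectations and Harris' inequality -/

section BernSum

variable {α : Type*} [DecidableEq α] {p : ℝ} {V : Finset α} {f g : Finset α → ℝ}

theorem bernSum_insert {x : α} (hx : x ∉ V) :
    bernSum p (insert x V) g =
      p * bernSum p V (fun T => g (insert x T)) + (1 - p) * bernSum p V g := by
  rw [bernSum, Finset.sum_powerset_insert hx, add_comm, bernSum, bernSum, Finset.mul_sum,
    Finset.mul_sum]
  congr 1 <;> refine Finset.sum_congr rfl fun T hT => ?_
  · have hxT : x ∉ T := fun h => hx (Finset.mem_powerset.1 hT h)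
    rw [Finset.card_insert_of_notMem hxT, Finset.insert_sdiff_insert,
      Finset.sdiff_insert_of_notMem hx]
    ring
  · have hxT : x ∉ T := fun h => hx (Finset.mem_powerset.1 hT h)
    rw [Finset.insert_sdiff_of_notMem _ hxT, Finset.card_insert_of_notMem (by simp [hx])]
    ring

theorem bernSum_mono (hp₀ : 0 ≤ p) (hp₁ : p ≤ 1) (h : ∀ T ⊆ V, f T ≤ g T) :
    bernSum p V f ≤ bernSum p V g :=
  Finset.sum_le_sum fun T hT => mul_le_mul_of_nonneg_left (h T (Finset.mem_powerset.1 hT))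
    (mul_nonneg (pow_nonneg hp₀ _) (pow_nonneg (sub_nonneg.2 hp₁) _))

theorem bernSum_congr (h : ∀ T ⊆ V, f T = g T) : bernSum p V f = bernSum p V g :=
  Finset.sum_congr rfl fun T hT => by rw [h T (Finset.mem_powerset.1 hT)]

theorem bernSum_const (c : ℝ) : bernSum p V (fun _ => c) = c := by
  induction V using Finset.induction_on with
  | empty => simp [bernSum]
  | insert x V hx ih => rw [bernSum_insert hx, ih]; ring

theorem bernSum_const_mul (c : ℝ) : bernSum p V (fun T => c * f T) = c * bernSum p V f := by
  rw [bernSum, bernSum, Finset.mul_sum]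
  exact Finset.sum_congr rfl fun T _ => by ring

theorem bernSum_sub : bernSum p V (fun T => f T - g T) = bernSum p V f - bernSum p V g := by
  rw [bernSum, bernSum, bernSum, ← Finset.sum_sub_distrib]
  exact Finset.sum_congr rfl fun T _ => by ring

theorem bernSum_nonneg (hp₀ : 0 ≤ p) (hp₁ : p ≤ 1) (h : ∀ T, 0 ≤ f T) : 0 ≤ bernSum p V f :=
  Finset.sum_nonneg fun T _ => mul_nonneg
    (mul_nonneg (pow_nonneg hp₀ _) (pow_nonneg (sub_nonneg.2 hp₁) _)) (h T)

/-- Harris' inequality. -/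
theorem bernSum_mul_le (hp₀ : 0 ≤ p) (hp₁ : p ≤ 1) (hf : Antitone f) (hg : Antitone g) :
    bernSum p V f * bernSum p V g ≤ bernSum p V fun T => f T * g T := by
  induction V using Finset.induction_on generalizing f g with
  | empty => simp [bernSum]
  | insert x V hx ih =>
    have hins : Monotone fun T : Finset α => insert x T := fun S T h => Finset.insert_subset_insert x h
    have h1 := ih (hf.comp_monotone hins) (hg.comp_monotone hins)
    have h0 := ih hf hg
    have hf' : bernSum p V (f ∘ fun T => insert x T) ≤ bernSum p V f :=
      bernSum_mono hp₀ hp₁ fun T _ => hf (Finset.subset_insert x T)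
    have hg' : bernSum p V (g ∘ fun T => insert x T) ≤ bernSum p V g :=
      bernSum_mono hp₀ hp₁ fun T _ => hg (Finset.subset_insert x T)
    simp only [bernSum_insert hx]
    simp only [Function.comp_def] at h1 hf' hg'
    have hp' := sub_nonneg.2 hp₁
    -- Conditioning on `x`, the covariance is the average of the two conditional covariances plus
    -- p(1-p) times the product of the increments of the two conditional means; these increments
    -- have the same sign.
    nlinarith [mul_le_mul_of_nonneg_left h1 hp₀, mul_le_mul_of_nonneg_left h0 hp',
      mul_nonneg (mul_nonneg hp₀ hp') (mul_nonneg (sub_nonneg.2 hf') (sub_nonneg.2 hg'))]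

end BernSum

/-! ### Comparing a density with a tilted higher density -/

section Comparison

variable {d : ℕ} {A B T T' U : Finset (Site d)} {p q h : ℝ}

theorem reach_finite (A T : Finset (Site d)) : {y | Reach (A : Set (Site d)) T y}.Finite :=
  (A.finite_toSet.union T.finite_toSet).subset fun _ hy => Reach.mem_union hy

/-- The number of sites reached from `A` through `T`. -/
noncomputable def reachCard (A T : Finset (Site d)) : ℕ := {y | Reach (A : Set (Site d)) T y}.ncard

theorem reachCard_mono (hA : A ⊆ B) (hT : T ⊆ T') : reachCard A T ≤ reachCard B T' :=
  Set.ncard_le_ncard (fun _ hy => Reach.mono (by exact_mod_cast hA) (by exact_mod_cast hT) hy)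
    (reach_finite B T')

theorem reachCard_union_le (A B T : Finset (Site d)) :
    reachCard (A ∪ B) T ≤ reachCard A T + reachCard B T := by
  refine (Set.ncard_le_ncard (fun y hy => ?_) ((reach_finite A T).union (reach_finite B T))).trans
    (Set.ncard_union_le _ _)
  have hy' : Reach ((A ∪ B : Finset (Site d)) : Set (Site d)) T y := hy
  rw [Finset.coe_union] at hy'
  exact hy'.of_union

theorem reachCard_insert {a x : Site d} (ha : a ∈ A) (hx : Nbr a x) (T : Finset (Site d)) :
    reachCard A (insert x T) = reachCard (insert x A) T := by
  simp only [reachCard, Finset.coe_insert, reach_insert_iff (Finset.mem_coe.2 ha) hx]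

theorem reachCard_eq_card (hT : ∀ x ∈ A, ∀ y ∈ T, ¬ Nbr x y) : reachCard A T = A.card := by
  rw [← Set.ncard_coe_finset, reachCard]
  congr 1
  ext y
  exact ⟨fun hy => Reach.mem_of_not_nbr (by exact_mod_cast hT) hy, fun hy => .base hy⟩

/-- The Laplace transform of the number of sites reached from `A` through the occupied sites of
`U`. -/
noncomputable def reachLaplace (p h : ℝ) (A U : Finset (Site d)) : ℝ :=
  bernSum p U fun T => Real.exp (-(h * reachCard A T))

theorem reachLaplace_nonneg (hp₀ : 0 ≤ p) (hp₁ : p ≤ 1) : 0 ≤ reachLaplace p h A U :=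
  bernSum_nonneg hp₀ hp₁ fun _ => (Real.exp_pos _).le

theorem reachLaplace_anti (hp₀ : 0 ≤ p) (hp₁ : p ≤ 1) (hh : 0 ≤ h) (hAB : A ⊆ B) :
    reachLaplace p h B U ≤ reachLaplace p h A U := by
  refine bernSum_mono hp₀ hp₁ fun T _ => Real.exp_le_exp.2 (neg_le_neg ?_)
  exact mul_le_mul_of_nonneg_left (by exact_mod_cast reachCard_mono hAB subset_rfl) hh

/-- Harris' inequality together with subadditivity of the reached count. With `B` a single site, it
bounds the cost of one more explored site under the tilt. -/
theorem reachLaplace_mul_le (hp₀ : 0 ≤ p) (hp₁ : p ≤ 1) (hh : 0 ≤ h) :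
    reachLaplace p h A U * reachLaplace p h B U ≤ reachLaplace p h (A ∪ B) U := by
  have hanti : ∀ A : Finset (Site d), Antitone fun T => Real.exp (-(h * reachCard A T)) :=
    fun A T T' hT => Real.exp_le_exp.2 (neg_le_neg (mul_le_mul_of_nonneg_left
      (by exact_mod_cast reachCard_mono subset_rfl hT) hh))
  refine (bernSum_mul_le hp₀ hp₁ (hanti A) (hanti B)).trans
    (bernSum_mono hp₀ hp₁ fun T _ => ?_)
  rw [← Real.exp_add, Real.exp_le_exp, ← neg_add, ← mul_add]
  exact neg_le_neg (mul_le_mul_of_nonneg_left (by exact_mod_cast reachCard_union_le A B T) hh)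

/-- The law of the cluster at density `q` is dominated by the law at a higher density `p` tilted
by `exp (-h |C|)`, when `h` is small. -/
theorem bernSum_mul_reachLaplace_le {c : ℝ} (hp₀ : 0 ≤ p) (hp₁ : p ≤ 1) (hq₀ : 0 ≤ q) (hq₁ : q ≤ 1)
    (hh : 0 ≤ h) (hqc : q ≤ p * c)
    (hc : ∀ (x : Site d) (U : Finset (Site d)), x ∉ U → c ≤ reachLaplace p h {x} U)
    {f : ℕ → ℝ} (hf : Monotone f) (U A : Finset (Site d)) :
    bernSum q U (fun T => f (reachCard A T)) * reachLaplace p h A U ≤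
      bernSum p U fun T => f (reachCard A T) * Real.exp (-(h * reachCard A T)) := by
  induction hn : U.card generalizing U A with
  | zero =>
    rw [Finset.card_eq_zero] at hn
    simp [hn, bernSum, reachLaplace]
  | succ n ih =>
    by_cases hx : ∃ x ∈ U, ∃ a ∈ A, Nbr a x
    · obtain ⟨x, hxU, a, ha, hax⟩ := hx
      obtain ⟨U, hxU', rfl⟩ : ∃ U', x ∉ U' ∧ insert x U' = U :=
        ⟨U.erase x, Finset.notMem_erase x U, Finset.insert_erase hxU⟩
      rw [Finset.card_insert_of_notMem hxU', Nat.add_right_cancel_iff] at hn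
      have h1 := ih U (insert x A) hn
      have h0 := ih U A hn
      rw [reachLaplace, bernSum_insert hxU', bernSum_insert hxU', bernSum_insert hxU']
      simp only [reachCard_insert ha hax]
      change (_ + _) * (p * reachLaplace p h (insert x A) U + (1 - p) * reachLaplace p h A U) ≤ _
      have hαβ := reachLaplace_anti (U := U) hp₀ hp₁ hh (Finset.subset_insert x A)
      have hβ := reachLaplace_nonneg (h := h) (A := A) (U := U) hp₀ hp₁
      -- Here `α` and `β` below are the tilted weights after finding `x` occupied or vacant.
      have hα : c * reachLaplace p h A U ≤ reachLaplace p h (insert x A) U := by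
        rw [Finset.insert_eq]
        exact (mul_le_mul_of_nonneg_right (hc x U hxU') hβ).trans (reachLaplace_mul_le hp₀ hp₁ hh)
      have hf01 : bernSum q U (fun T => f (reachCard A T)) ≤
          bernSum q U (fun T => f (reachCard (insert x A) T)) :=
        bernSum_mono hq₀ hq₁ fun T _ => hf (reachCard_mono (Finset.subset_insert x A) subset_rfl)
      have hp' := sub_nonneg.2 hp₁
      set α := reachLaplace p h (insert x A) U
      set β := reachLaplace p h A U
      -- Under the tilted law `x` is occupied with conditional probability pα / (pα + (1-p)β), and
      -- this is at least `q`.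
      have hw : q * (p * α + (1 - p) * β) ≤ p * α :=
        calc q * (p * α + (1 - p) * β) ≤ q * β := by
              refine mul_le_mul_of_nonneg_left ?_ hq₀
              nlinarith
          _ ≤ p * c * β := mul_le_mul_of_nonneg_right hqc hβ
          _ = p * (c * β) := by ring
          _ ≤ p * α := mul_le_mul_of_nonneg_left hα hp₀
      -- Raising the occupation probability of `x` from `q` to its tilted value can only increase
      -- the expectation of the monotone `f`; the two induction hypotheses then finish.
      have key := mul_nonneg (sub_nonneg.2 hw) (sub_nonneg.2 hf01)
      have h1' := mul_le_mul_of_nonneg_left h1 hp₀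
      have h0' := mul_le_mul_of_nonneg_left h0 hp'
      linarith
    -- No site of `U` touches `A`: the exploration has stopped, the count is frozen at `A.card`, and
    -- both sides agree.
    · push Not at hx
      have hK : ∀ T ⊆ U, reachCard A T = A.card := fun T hT =>
        reachCard_eq_card fun a ha y hy => hx y (hT hy) a ha
      have hK' : ∀ (r : ℝ) (g : ℕ → ℝ), bernSum r U (fun T => g (reachCard A T)) = g A.card :=
        fun r g => (bernSum_congr (g := fun _ => g A.card) fun T hT => by rw [hK T hT]).trans
          (bernSum_const _)
      rw [reachLaplace, hK' q f, hK' p fun k => Real.exp (-(h * k)),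
        hK' p fun k => f k * Real.exp (-(h * k))]

end Comparison

/-! ### Balls and translation invariance of the tail -/

/-- The sites at `ℓ^∞`-distance at most `n` from `x`. -/
noncomputable def ball {d : ℕ} (x : Site d) (n : ℕ) : Finset (Site d) :=
  Fintype.piFinset fun i => Finset.Icc (x i - n) (x i + n)

section Ball

variable {d n : ℕ} {x y : Site d}

theorem mem_ball : y ∈ ball x n ↔ ∀ i, |y i - x i| ≤ n := by
  simp only [ball, Fintype.mem_piFinset, Finset.mem_Icc, abs_le]
  exact forall_congr' fun i => by constructor <;> intro h <;> constructor <;> linarith [h.1, h.2]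

theorem card_ball : (ball x n).card = (2 * n + 1) ^ d := by
  have : ∀ i, x i + n + 1 - (x i - n) = ((2 * n + 1 : ℕ) : ℤ) := fun i => by push_cast; ring
  simp only [ball, Fintype.card_piFinset, Int.card_Icc, this, Int.toNat_natCast, Finset.prod_const,
    Finset.card_univ, Fintype.card_fin]

theorem mem_ball_zero_iff : y ∈ ball (0 : Site d) n ↔ y ∈ box d n := by
  simp [mem_ball, box]

theorem Animal.subset_ball {S : Finset (Site d)} (h : Animal x S) : S ⊆ ball x S.card :=
  fun y hy => mem_ball.2 fun i => (h.abs_sub_lt y hy i).le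

theorem eventOn_animalEvent (x : Site d) (n : ℕ) : EventOn (animalEvent x n) (ball x n) := by
  rintro ω ω' hw ⟨S, hS, rfl, ho⟩
  exact ⟨S, hS, rfl, fun y hy => (hw y (hS.subset_ball hy)).symm.trans (ho y hy)⟩

theorem measure_animalEvent (p : unitInterval) (x : Site d) (n : ℕ) :
    (bernoulliSite d p).real (animalEvent x n) = (bernoulliSite d p).real (animalEvent 0 n) := by
  rw [← (eventOn_animalEvent (0 : Site d) n).measure_shift p x]
  congr 1
  ext ω
  constructor
  · rintro ⟨S, hS, hc, ho⟩
    refine ⟨S.map (addRightEmbedding (-x)), by simpa using hS.map_add (-x), by simpa, ?_⟩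
    simpa using ho
  · rintro ⟨S, hS, hc, ho⟩
    refine ⟨S.map (addRightEmbedding x), by simpa using hS.map_add x, by simpa, ?_⟩
    simpa using ho

theorem clusterTail_eq {p : unitInterval} (hn : n ≠ 0) (x : Site d) :
    clusterTail d p n = (bernoulliSite d p).real (animalEvent x n) := by
  rw [measure_animalEvent, clusterTail]
  congr 1
  ext ω
  exact le_encard_cluster_iff hn

end Ball

/-! ### Exponential decay below the critical value -/

section Decay

variable {d : ℕ} {p : unitInterval}

-- The reached count takes the root for granted, whereas the cluster needs it occupied; this
-- independent requirement is the factor `p`.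
open Classical in
theorem mul_bernSum_reachCard_le {k : ℕ} (hk : k ≠ 0) {x : Site d} {U : Finset (Site d)}
    (hx : x ∉ U) :
    (p : ℝ) * bernSum p U (fun T => if k ≤ reachCard {x} T then 1 else 0) ≤ clusterTail d p k := by
  set E : Set (Config d) :=
    {ω | ∃ S, Animal x S ∧ S.card = k ∧ S ⊆ insert x U ∧ ∀ y ∈ S, ω y = true}
  have hE : EventOn E (insert x U) := by
    rintro ω ω' hw ⟨S, hS, hc, hU, ho⟩
    exact ⟨S, hS, hc, hU, fun y hy => (hw y (hU hy)).symm.trans (ho y hy)⟩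
  rw [clusterTail_eq hk x]
  refine le_trans ?_ (measureReal_mono (μ := bernoulliSite d p) (s₁ := E) ?_)
  · rw [hE.measure_eq, bernSum_insert hx]
    refine le_trans (mul_le_mul_of_nonneg_left (bernSum_mono p.2.1 p.2.2 fun T hT => ?_) p.2.1)
      (le_add_of_nonneg_right (mul_nonneg (sub_nonneg.2 p.2.2)
        (bernSum_nonneg p.2.1 p.2.2 fun T => by positivity)))
    by_cases h : k ≤ reachCard {x} T
    · have : occ (insert x T) ∈ E := by
        obtain ⟨n, rfl⟩ := Nat.exists_eq_succ_of_ne_zero hk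
        have h' : ((n + 1 : ℕ) : ℕ∞) ≤ {y | Reach {x} (T : Set (Site d)) y}.encard := by
          have hf := reach_finite {x} T
          rw [Finset.coe_singleton] at hf
          rw [← hf.cast_ncard_eq]
          have h'' : n + 1 ≤ {y | Reach (({x} : Finset (Site d)) : Set (Site d)) T y}.ncard := h
          rw [Finset.coe_singleton] at h''
          exact_mod_cast h''
        obtain ⟨S, hS, hc, hr⟩ := exists_animal h'
        have hmem : ∀ y ∈ S, y ∈ insert x T := fun y hy => by simpa using (hr y hy).mem_union
        exact ⟨S, hS, hc, fun y hy => Finset.insert_subset_insert x hT (hmem y hy),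
          fun y hy => by simpa [occ] using hmem y hy⟩
      simp [this, h]
    · rw [if_neg h]
      positivity
  · rintro ω ⟨S, hS, hc, hU, ho⟩
    exact ⟨S, hS, hc, ho⟩

/-- Keep only the configurations reaching fewer than `k` sites. The bound is uniform in `U`, as the
exploration argument requires. -/
theorem le_reachLaplace {k : ℕ} (hk : k ≠ 0) {h : ℝ} (hh : 0 ≤ h) (hp : 0 < (p : ℝ)) {x : Site d}
    {U : Finset (Site d)} (hx : x ∉ U) :
    Real.exp (-(h * k)) * (1 - clusterTail d p k / p) ≤ reachLaplace p h {x} U := by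
  classical
  have h1 : bernSum (p : ℝ) U (fun T => if k ≤ reachCard {x} T then 1 else 0) ≤
      clusterTail d p k / p := by
    rw [le_div_iff₀ hp, mul_comm]
    exact mul_bernSum_reachCard_le hk hx
  calc _ ≤ Real.exp (-(h * k)) *
        (1 - bernSum (p : ℝ) U (fun T => if k ≤ reachCard {x} T then 1 else 0)) :=
        mul_le_mul_of_nonneg_left (by linarith) (Real.exp_pos _).le
    _ = bernSum (p : ℝ) U fun T =>
        Real.exp (-(h * k)) * (1 - if k ≤ reachCard {x} T then 1 else 0) := by
        rw [bernSum_const_mul, bernSum_sub, bernSum_const]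
    _ ≤ _ := by
        refine bernSum_mono p.2.1 p.2.2 fun T _ => ?_
        split_ifs with hc
        · simpa using (Real.exp_pos _).le
        · rw [sub_zero, mul_one, Real.exp_le_exp]
          exact neg_le_neg (mul_le_mul_of_nonneg_left (by exact_mod_cast (not_le.1 hc).le) hh)

theorem measurableSet_le_encard_cluster (n : ℕ) :
    MeasurableSet {ω : Config d | (n : ℕ∞) ≤ (cluster ω (0 : Site d)).encard} := by
  by_cases hn : n = 0
  · simp [hn]
  · have : {ω : Config d | (n : ℕ∞) ≤ (cluster ω (0 : Site d)).encard} = animalEvent 0 n := by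
      ext ω
      exact le_encard_cluster_iff hn
    rw [this]
    exact (eventOn_animalEvent _ _).measurableSet

/-- Continuity from above: the events decrease to that of an infinite cluster at the origin. -/
theorem tendsto_clusterTail (h : ∀ᵐ ω ∂(bernoulliSite d p), ∀ x, (cluster ω x).Finite) :
    Tendsto (clusterTail d p) atTop (𝓝 0) := by
  have hanti : Antitone fun n : ℕ => {ω : Config d | (n : ℕ∞) ≤ (cluster ω (0 : Site d)).encard} :=
    fun m n hmn ω hω => le_trans (Nat.cast_le.2 hmn : (m : ℕ∞) ≤ n) hω
  have hlim := tendsto_measure_iInter_atTop (μ := bernoulliSite d p)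
    (fun n => (measurableSet_le_encard_cluster n).nullMeasurableSet) hanti ⟨0, measure_ne_top _ _⟩
  have hzero : bernoulliSite d p
      (⋂ n : ℕ, {ω : Config d | (n : ℕ∞) ≤ (cluster ω (0 : Site d)).encard}) = 0 := by
    refine measure_mono_null ?_ (ae_iff.1 h)
    intro ω hω hfin
    have h1 := Set.mem_iInter.1 hω ((cluster ω 0).ncard + 1)
    have h2 : (((cluster ω (0 : Site d)).ncard + 1 : ℕ) : ℕ∞) ≤ (cluster ω (0 : Site d)).encard := h1
    rw [← (hfin 0).cast_ncard_eq] at h2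
    norm_cast at h2
    omega
  rw [hzero] at hlim
  exact (ENNReal.tendsto_toReal ENNReal.zero_ne_top).comp hlim

theorem clusterTail_le_one (n : ℕ) : clusterTail d p n ≤ 1 := measureReal_le_one

open Classical in
theorem clusterTail_le_bernSum {n : ℕ} (hn : n ≠ 0) :
    clusterTail d p n ≤ bernSum (p : ℝ) ((ball (0 : Site d) n).erase 0) fun T =>
      if n ≤ reachCard {0} T then 1 else 0 := by
  have h0 : (0 : Site d) ∈ ball (0 : Site d) n := mem_ball.2 (by simp)
  rw [clusterTail_eq hn 0, (eventOn_animalEvent 0 n).measure_eq, ← Finset.insert_erase h0,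
    bernSum_insert (by simp), Finset.erase_insert (by simp)]
  set U := (ball (0 : Site d) n).erase 0
  have hz : bernSum (p : ℝ) U (fun T => if occ T ∈ animalEvent (0 : Site d) n then 1 else 0) = 0 := by
    rw [bernSum_congr (g := fun _ => 0), bernSum_const]
    intro T hT
    rw [if_neg]
    rintro ⟨S, hS, -, ho⟩
    have := ho 0 hS.root_mem
    simp only [occ, decide_eq_true_eq] at this
    simpa [U] using hT this
  rw [hz, mul_zero, add_zero]
  refine (mul_le_of_le_one_left (bernSum_nonneg p.2.1 p.2.2 fun T => by positivity) p.2.2).trans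
    (bernSum_mono p.2.1 p.2.2 fun T hT => ?_)
  by_cases h : occ (insert 0 T) ∈ animalEvent (0 : Site d) n
  · have : n ≤ reachCard {0} T := by
      obtain ⟨S, hS, rfl, ho⟩ := h
      rw [reachCard, ← Set.ncard_coe_finset]
      refine Set.ncard_le_ncard (fun y hy => ?_) (reach_finite _ _)
      rw [Finset.coe_singleton]
      exact (hS.reach (A := {0}) (T := insert 0 (T : Set (Site d))) rfl
        (fun y hy => by simpa [occ] using ho y hy) y hy).of_insert rfl
    simp [this, h]
  · rw [if_neg h]
    positivity

theorem exists_clusterTail_le_exp {p' : unitInterval} (hp : 0 < (p : ℝ)) (hpp' : (p : ℝ) < p')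
    (h : ∀ᵐ ω ∂(bernoulliSite d p'), ∀ x, (cluster ω x).Finite) :
    ∃ a > 0, ∃ C, 0 < C ∧ ∀ n : ℕ, n ≠ 0 → clusterTail d p n ≤ C * Real.exp (-(a * n)) := by
  classical
  have hp' : 0 < (p' : ℝ) := hp.trans hpp'
  obtain ⟨k, hk, hk0⟩ := (((tendsto_clusterTail h).eventually
    (gt_mem_nhds (show 0 < ((p' : ℝ) - p) / 2 by linarith))).and (eventually_ne_atTop 0)).exists
  have hk0' : (0 : ℝ) < k := by exact_mod_cast Nat.pos_of_ne_zero hk0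
  have hr : 1 < ((p' : ℝ) + p) / (2 * p) := by rw [lt_div_iff₀ (by linarith)]; linarith
  -- Chosen so that exp(-ak) = 2p/(p'+p). By the choice of `k`, the other factor in
  -- `le_reachLaplace` is at least (p'+p)/(2p'). The product is p/p', exactly the constant needed to
  -- descend from `p'` to `p`.
  set a := Real.log (((p' : ℝ) + p) / (2 * p)) / k
  have ha : 0 < a := div_pos (Real.log_pos hr) hk0'
  have hexp : Real.exp (-(a * k)) = 2 * p / (p' + p) := by
    rw [div_mul_cancel₀ _ hk0'.ne', Real.exp_neg, Real.exp_log (by positivity), inv_div]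
  have hc : ∀ (x : Site d) (U : Finset (Site d)), x ∉ U → (p / p' : ℝ) ≤ reachLaplace p' a {x} U := by
    intro x U hx
    refine le_trans ?_ (le_reachLaplace hk0 ha.le hp' hx)
    rw [hexp]
    have : ((p' : ℝ) + p) / (2 * p') ≤ 1 - clusterTail d p' k / p' := by
      rw [div_le_iff₀ (by positivity)]
      field_simp
      linarith
    calc (p / p' : ℝ) = 2 * p / (p' + p) * (((p' : ℝ) + p) / (2 * p')) := by field_simp
      _ ≤ _ := mul_le_mul_of_nonneg_left this (by positivity)
  refine ⟨a, ha, p' / p, by positivity, fun n hn => ?_⟩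
  have hmono : Monotone fun k : ℕ => if n ≤ k then (1 : ℝ) else 0 := by
    intro k l hkl
    by_cases h : n ≤ k
    · simp [h, h.trans hkl]
    · simp only [if_neg h]
      positivity
  have hcmp := bernSum_mul_reachLaplace_le p'.2.1 p'.2.2 p.2.1 p.2.2 ha.le
    (c := p / p') (by field_simp; rfl) hc hmono ((ball (0 : Site d) n).erase 0) {0}
  -- On the event that at least `n` sites are reached, the tilt itself is at most exp(-an); this is
  -- the source of the decay.
  have hup : (bernSum (p' : ℝ) ((ball (0 : Site d) n).erase 0) fun T =>
      (if n ≤ reachCard {0} T then (1 : ℝ) else 0) * Real.exp (-(a * reachCard {0} T))) ≤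
      Real.exp (-(a * n)) := by
    refine (bernSum_mono p'.2.1 p'.2.2 fun T _ => ?_).trans (bernSum_const _).le
    split_ifs with h
    · rw [one_mul, Real.exp_le_exp]
      exact neg_le_neg (mul_le_mul_of_nonneg_left (by exact_mod_cast h) ha.le)
    · rw [zero_mul]
      positivity
  have hlow := mul_le_mul_of_nonneg_left (hc 0 ((ball (0 : Site d) n).erase 0) (by simp))
    (bernSum_nonneg (V := (ball (0 : Site d) n).erase 0) p.2.1 p.2.2
      (f := fun T => if n ≤ reachCard {0} T then (1 : ℝ) else 0) fun T => by positivity)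
  have hlow' := mul_le_mul_of_nonneg_right (clusterTail_le_bernSum (d := d) (p := p) hn)
    (show 0 ≤ (p / p' : ℝ) by positivity)
  have := hlow'.trans (hlow.trans (hcmp.trans hup))
  rw [mul_div_assoc', div_le_iff₀ hp'] at this
  rw [div_mul_eq_mul_div, le_div_iff₀ hp]
  linarith

end Decay

/-! ### Supermultiplicativity and existence of the rate -/

section Connectivity

variable {d : ℕ} {p : unitInterval}

/-- The event that `x` is the left endpoint of a connected set of `n` occupied sites. -/
def leftEvent {d : ℕ} (x : Site d) (n : ℕ) : Set (Config d) :=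
  {ω | ∃ S, Animal x S ∧ S.card = n ∧ (∀ y ∈ S, toLex x ≤ toLex y) ∧ ∀ y ∈ S, ω y = true}

/-- The event that `x` and `y` are the extreme points of a connected set of `n` occupied
sites. -/
def leftRightEvent {d : ℕ} (x y : Site d) (n : ℕ) : Set (Config d) :=
  {ω | ∃ S, Animal x S ∧ S.card = n ∧ (∀ z ∈ S, toLex x ≤ toLex z) ∧
    (y ∈ S ∧ ∀ z ∈ S, toLex z ≤ toLex y) ∧ ∀ z ∈ S, ω z = true}

theorem toLex_le_add_iff (x y a : Site d) : toLex (x + a) ≤ toLex (y + a) ↔ toLex x ≤ toLex y := by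
  rw [toLex_add, toLex_add]
  exact add_le_add_iff_right _

theorem toLex_lt_add_single (x : Site d) (i : Fin d) : toLex x < toLex (x + Pi.single i 1) := by
  refine Pi.toLex_strictMono (lt_of_le_of_ne (fun j => ?_) fun h => ?_)
  · by_cases hj : j = i
    · subst hj; simp
    · simp [hj]
  · have := congrFun h i
    simp at this

theorem leftEvent_subset (x : Site d) (n : ℕ) : leftEvent x n ⊆ animalEvent x n :=
  fun _ ⟨S, hS, hc, _, ho⟩ => ⟨S, hS, hc, ho⟩

theorem eventOn_leftEvent (x : Site d) (n : ℕ) :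
    EventOn (leftEvent x n) ((ball x n).filter fun y => toLex x ≤ toLex y) := by
  rintro ω ω' hw ⟨S, hS, rfl, hx, ho⟩
  exact ⟨S, hS, rfl, hx, fun y hy =>
    (hw y (Finset.mem_filter.2 ⟨hS.subset_ball hy, hx y hy⟩)).symm.trans (ho y hy)⟩

theorem eventOn_leftRightEvent (x y : Site d) (n : ℕ) :
    EventOn (leftRightEvent x y n) ((ball x n).filter fun z => toLex z ≤ toLex y) := by
  rintro ω ω' hw ⟨S, hS, rfl, hx, hy, ho⟩
  exact ⟨S, hS, rfl, hx, hy, fun z hz =>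
    (hw z (Finset.mem_filter.2 ⟨hS.subset_ball hz, hy.2 z hz⟩)).symm.trans (ho z hz)⟩

theorem measure_leftEvent (p : unitInterval) (x : Site d) (n : ℕ) :
    (bernoulliSite d p).real (leftEvent x n) = (bernoulliSite d p).real (leftEvent 0 n) := by
  rw [← (eventOn_leftEvent (0 : Site d) n).measure_shift p x]
  congr 1
  ext ω
  constructor
  · rintro ⟨S, hS, hc, hx, ho⟩
    refine ⟨S.map (addRightEmbedding (-x)), by simpa using hS.map_add (-x), by simpa, ?_, ?_⟩
    · intro y hy
      obtain ⟨z, hz, rfl⟩ := Finset.mem_map.1 hy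
      have := (toLex_le_add_iff _ _ (-x)).2 (hx z hz)
      simpa using this
    · simpa using ho
  · rintro ⟨S, hS, hc, hx, ho⟩
    refine ⟨S.map (addRightEmbedding x), by simpa using hS.map_add x, by simpa, ?_, ?_⟩
    · intro y hy
      obtain ⟨z, hz, rfl⟩ := Finset.mem_map.1 hy
      have := (toLex_le_add_iff _ _ x).2 (hx z hz)
      simpa using this
    · simpa using ho

/-- The first animal lies at or below `y` in the lexicographic order and the second strictly above,
so they are disjoint, and they are joined by the edge from `y`. -/
theorem leftEvent_inter_subset (i : Fin d) (x y : Site d) (m n : ℕ) :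
    leftRightEvent x y m ∩ leftEvent (y + Pi.single i 1) n ⊆ leftEvent x (m + n) := by
  rintro ω ⟨⟨S, hS, rfl, hx, ⟨hyS, hy⟩, ho⟩, ⟨S', hS', rfl, hx', ho'⟩⟩
  have hlt := toLex_lt_add_single y i
  have hd : Disjoint S S' := Finset.disjoint_left.2 fun z hz hz' =>
    absurd ((hx' z hz').trans (hy z hz)) (not_le.2 hlt)
  refine ⟨S ∪ S', hS.union hS' hyS (nbr_add_single y i) hd, Finset.card_union_of_disjoint hd,
    ?_, ?_⟩
  · intro z hz
    rcases Finset.mem_union.1 hz with hz | hz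
    · exact hx z hz
    · exact ((hx y hyS).trans hlt.le).trans (hx' z hz)
  · intro z hz
    rcases Finset.mem_union.1 hz with hz | hz
    exacts [ho z hz, ho' z hz]

theorem leftEvent_mul_le (hd : 1 ≤ d) (m n : ℕ) :
    (bernoulliSite d p).real (leftEvent 0 m) * (bernoulliSite d p).real (leftEvent 0 n) ≤
      (bernoulliSite d p).real (leftEvent 0 (m + n)) := by
  classical
  let i : Fin d := ⟨0, hd⟩
  -- Select the smallest possible right endpoint `y`. This makes the events disjoint, while each
  -- still depends only on sites at or below `y`, hence is independent of what starts at the next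
  -- site.
  set D : Site d → Set (Config d) := fun y => leftRightEvent 0 y m \
    ⋃ z ∈ (ball (0 : Site d) m).filter (fun z => toLex z < toLex y), leftRightEvent 0 z m
  have hD : ∀ y, EventOn (D y) ((ball (0 : Site d) m).filter fun z => toLex z ≤ toLex y) := by
    refine fun y => (eventOn_leftRightEvent 0 y m).diff (EventOn.biUnion fun z hz => ?_)
    refine (eventOn_leftRightEvent 0 z m).mono fun w hw => ?_
    rw [Finset.mem_filter] at hw hz ⊢
    exact ⟨hw.1, hw.2.trans hz.2.le⟩
  have hdisj : ∀ y ∈ ball (0 : Site d) m, ∀ z, toLex y < toLex z → Disjoint (D y) (D z) := by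
    intro y hy z hyz
    refine Set.disjoint_left.2 fun ω hω hω' => hω'.2 ?_
    simp only [Set.mem_iUnion]
    exact ⟨y, Finset.mem_filter.2 ⟨hy, hyz⟩, hω.1⟩
  have hpd : Set.PairwiseDisjoint (ball (0 : Site d) m : Set (Site d)) D := by
    intro y hy z hz hne
    rcases lt_trichotomy (toLex y) (toLex z) with h | h | h
    · exact hdisj y hy z h
    · exact absurd (toLex.injective h) hne
    · exact (hdisj z hz y h).symm
  have hcov : leftEvent 0 m ⊆ ⋃ y ∈ ball (0 : Site d) m, D y := by
    rintro ω ⟨S, hS, hc, hx, ho⟩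
    obtain ⟨w, hwS, hw⟩ := Finset.exists_max_image S toLex ⟨0, hS.root_mem⟩
    have hsub : S ⊆ ball 0 m := hc ▸ hS.subset_ball
    obtain ⟨y, hy, hmin⟩ := Finset.exists_min_image
      ((ball (0 : Site d) m).filter fun y => ω ∈ leftRightEvent 0 y m) toLex
      ⟨w, Finset.mem_filter.2 ⟨hsub hwS, S, hS, hc, hx, ⟨hwS, hw⟩, ho⟩⟩
    rw [Finset.mem_filter] at hy
    simp only [Set.mem_iUnion]
    refine ⟨y, hy.1, hy.2, ?_⟩
    simp only [Set.mem_iUnion, not_exists]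
    intro z hz hωz
    rw [Finset.mem_filter] at hz
    exact absurd hz.2 (not_lt.2 (hmin z (Finset.mem_filter.2 ⟨hz.1, hωz⟩)))
  have hprod : ∀ y, (bernoulliSite d p).real (D y ∩ leftEvent (y + Pi.single i 1) n) =
      (bernoulliSite d p).real (D y) * (bernoulliSite d p).real (leftEvent 0 n) := by
    intro y
    rw [← measure_leftEvent p (y + Pi.single i 1)]
    refine (hD y).measure_inter (eventOn_leftEvent _ _) (Finset.disjoint_left.2 fun z hz hz' => ?_)
    rw [Finset.mem_filter] at hz hz'
    exact absurd (hz'.2.trans hz.2) (not_le.2 (toLex_lt_add_single y i))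
  calc _ ≤ (∑ y ∈ ball (0 : Site d) m, (bernoulliSite d p).real (D y)) *
          (bernoulliSite d p).real (leftEvent 0 n) := by
        refine mul_le_mul_of_nonneg_right ?_ measureReal_nonneg
        exact (measureReal_mono hcov (measure_ne_top _ _)).trans (measureReal_biUnion_finset_le _ _)
    _ = ∑ y ∈ ball (0 : Site d) m,
          (bernoulliSite d p).real (D y ∩ leftEvent (y + Pi.single i 1) n) := by
        rw [Finset.sum_mul]
        exact Finset.sum_congr rfl fun y _ => (hprod y).symm
    _ = (bernoulliSite d p).real (⋃ y ∈ ball (0 : Site d) m,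
          (D y ∩ leftEvent (y + Pi.single i 1) n)) := by
        rw [measureReal_biUnion_finset]
        · exact fun y hy z hz hne =>
            (hpd hy hz hne).mono Set.inter_subset_left Set.inter_subset_left
        · exact fun y _ => (hD y).measurableSet.inter (eventOn_leftEvent _ _).measurableSet
    _ ≤ _ := by
        refine measureReal_mono (Set.iUnion₂_subset fun y _ => ?_)
        exact (Set.inter_subset_inter_left _ Set.sdiff_subset).trans
          (leftEvent_inter_subset i 0 y m n)

theorem leftEvent_pos (hd : 1 ≤ d) (hp : 0 < (p : ℝ)) {n : ℕ} (hn : n ≠ 0) :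
    0 < (bernoulliSite d p).real (leftEvent 0 n) := by
  obtain ⟨n, rfl⟩ := Nat.exists_eq_succ_of_ne_zero hn
  have h1 : 0 < (bernoulliSite d p).real (leftEvent 0 1) := by
    have hev : leftEvent (0 : Site d) 1 = (({0} : Finset (Site d)) : Set (Site d)).pi
        fun _ => {true} := by
      ext ω
      simp only [Finset.coe_singleton, Set.singleton_pi', Set.mem_ofPred_eq, Set.mem_singleton_iff]
      constructor
      · rintro ⟨S, hS, -, -, ho⟩
        exact ho 0 hS.root_mem
      · intro h
        exact ⟨{0}, .single, by simp, by simp, by simpa using h⟩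
    rw [hev, Measure.real, bernoulliSite,
      Measure.infinitePi_pi _ (fun i _ => measurableSet_singleton _), Finset.prod_singleton,
      ← measureReal_def, bernoulliMeasure_real_apply _ (measurableSet_singleton _)]
    simpa using hp
  induction n with
  | zero => exact h1
  | succ n ih => exact (mul_pos (ih (by simp)) h1).trans_le (leftEvent_mul_le hd _ _)

theorem leftEvent_le_clusterTail {n : ℕ} (hn : n ≠ 0) :
    (bernoulliSite d p).real (leftEvent 0 n) ≤ clusterTail d p n := by
  rw [clusterTail_eq hn 0]
  exact measureReal_mono (leftEvent_subset 0 n)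

/-- Reroot an animal at its lexicographic minimum, which lies within distance `n` of the origin, and
sum over its positions. The polynomial factor does not affect the exponential rate. -/
theorem clusterTail_le_mul_leftEvent {n : ℕ} (hn : n ≠ 0) :
    clusterTail d p n ≤ (2 * n + 1) ^ d * (bernoulliSite d p).real (leftEvent 0 n) := by
  have hsub : animalEvent (0 : Site d) n ⊆ ⋃ x ∈ ball (0 : Site d) n, leftEvent x n := by
    rintro ω ⟨S, hS, rfl, ho⟩
    obtain ⟨x, hxS, hx⟩ := Finset.exists_min_image S toLex ⟨0, hS.root_mem⟩
    simp only [Set.mem_iUnion]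
    exact ⟨x, hS.subset_ball hxS, S, hS.reroot x hxS, rfl, hx, ho⟩
  rw [clusterTail_eq hn 0]
  refine (measureReal_mono hsub (measure_ne_top _ _)).trans ((measureReal_biUnion_finset_le _ _).trans ?_)
  rw [Finset.sum_congr rfl fun x _ => measure_leftEvent p x n, Finset.sum_const, card_ball,
    nsmul_eq_mul]
  push_cast
  rfl

theorem clusterTail_pos (hd : 1 ≤ d) (hp : 0 < (p : ℝ)) {n : ℕ} (hn : n ≠ 0) :
    0 < clusterTail d p n :=
  (leftEvent_pos hd hp hn).trans_le (leftEvent_le_clusterTail hn)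

theorem exists_tendsto_log_clusterTail (hd : 1 ≤ d) (hp : 0 < (p : ℝ)) :
    ∃ ζ : ℝ, Tendsto (fun n : ℕ => -(1 / (n : ℝ)) * Real.log (clusterTail d p n)) atTop (𝓝 ζ) := by
  set κ : ℕ → ℝ := fun n => (bernoulliSite d p).real (leftEvent 0 n)
  -- No animal is empty, so `Real.log (κ 0)` takes the default value 0 and subadditivity holds
  -- trivially when an index vanishes.
  have hκ0 : κ 0 = 0 := by
    have : leftEvent (0 : Site d) 0 = ∅ := by
      ext ω
      simp only [Set.mem_empty_iff_false, iff_false]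
      rintro ⟨S, hS, hc, -⟩
      exact hS.card_pos.ne' hc
    simp [κ, this]
  have hsub : Subadditive fun n => -Real.log (κ n) := by
    intro m n
    rcases eq_or_ne m 0 with rfl | hm
    · simp [hκ0]
    rcases eq_or_ne n 0 with rfl | hn
    · simp [hκ0]
    have hm' := leftEvent_pos hd hp hm
    have hn' := leftEvent_pos hd hp hn
    have := Real.log_le_log (mul_pos hm' hn') (leftEvent_mul_le hd m n)
    rw [Real.log_mul hm'.ne' hn'.ne'] at this
    simp only [κ]
    linarith
  have hbdd : BddBelow (Set.range fun n : ℕ => -Real.log (κ n) / n) := by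
    refine ⟨0, ?_⟩
    rintro _ ⟨n, rfl⟩
    exact div_nonneg (neg_nonneg.2 (Real.log_nonpos measureReal_nonneg measureReal_le_one))
      (Nat.cast_nonneg n)
  have hlim := hsub.tendsto_lim hbdd
  have hlog : Tendsto (fun n : ℕ => d * (Real.log (2 * n + 1) / n)) atTop (𝓝 0) := by
    -- The denominator is the inverse of n ↦ 2n+1.
    have h1 : Tendsto (fun x : ℝ => Real.log x / ((1 / 2) * x + (-1 / 2))) atTop (𝓝 0) :=
      by simpa using Real.tendsto_pow_log_div_mul_add_atTop (1 / 2) (-1 / 2) 1 (by norm_num)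
    have h2 : Tendsto (fun n : ℕ => 2 * (n : ℝ) + 1) atTop atTop :=
      tendsto_atTop_add_const_right _ _
        (tendsto_natCast_atTop_atTop.const_mul_atTop (by norm_num))
    have h3 := (h1.comp h2).const_mul (d : ℝ)
    rw [mul_zero] at h3
    refine h3.congr fun n => ?_
    simp only [Function.comp_apply]
    congr 2
    ring
  refine ⟨hsub.lim, tendsto_of_tendsto_of_tendsto_of_le_of_le' (by simpa using hlim.sub hlog) hlim
    ?_ ?_⟩
  · filter_upwards [eventually_ne_atTop 0] with n hn
    have hn' : (0 : ℝ) < n := by exact_mod_cast Nat.pos_of_ne_zero hn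
    have := Real.log_le_log (clusterTail_pos hd hp hn) (clusterTail_le_mul_leftEvent hn)
    rw [Real.log_mul (by positivity) (leftEvent_pos hd hp hn).ne', Real.log_pow] at this
    rw [mul_div_assoc', ← sub_div, neg_mul, one_div_mul_eq_div, ← neg_div,
      div_le_div_iff_of_pos_right hn']
    simp only [κ]
    linarith
  · filter_upwards [eventually_ne_atTop 0] with n hn
    have hn' : (0 : ℝ) < n := by exact_mod_cast Nat.pos_of_ne_zero hn
    have := Real.log_le_log (leftEvent_pos hd hp hn) (leftEvent_le_clusterTail hn)
    rw [neg_mul, one_div_mul_eq_div, ← neg_div, div_le_div_iff_of_pos_right hn']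
    exact neg_le_neg this

theorem exists_pos_tendsto_log_clusterTail (hd : 1 ≤ d) (hp : 0 < (p : ℝ))
    (hpc : (p : ℝ) < criticalValue d) :
    ∃ ζ : ℝ, 0 < ζ ∧
      Tendsto (fun n : ℕ => -(1 / (n : ℝ)) * Real.log (clusterTail d p n)) atTop (𝓝 ζ) := by
  obtain ⟨ζ, hζ⟩ := exists_tendsto_log_clusterTail hd hp
  refine ⟨ζ, ?_, hζ⟩
  have hne : {q : ℝ | ∃ p : unitInterval, (p : ℝ) = q ∧
      ∀ᵐ ω ∂(bernoulliSite d p), ∀ x, (cluster ω x).Finite}.Nonempty := by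
    by_contra hcon
    rw [Set.not_nonempty_iff_eq_empty] at hcon
    -- The supremum of the empty set is 0 by convention, which contradicts 0 < p < p_c.
    rw [criticalValue, hcon, Real.sSup_empty] at hpc
    exact absurd hpc hp.not_gt
  obtain ⟨_, ⟨p', rfl, hfin⟩, hpp'⟩ := exists_lt_of_lt_csSup hne hpc
  obtain ⟨a, ha, C, hC, hle⟩ := exists_clusterTail_le_exp hp hpp' hfin
  have hlim : Tendsto (fun n : ℕ => a - Real.log C / n) atTop (𝓝 (a - 0)) :=
    tendsto_const_nhds.sub (tendsto_natCast_atTop_atTop.const_div_atTop _)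
  rw [sub_zero] at hlim
  refine ha.trans_le (le_of_tendsto_of_tendsto hlim hζ ?_)
  filter_upwards [eventually_ne_atTop 0] with n hn
  have hn' : (0 : ℝ) < n := by exact_mod_cast Nat.pos_of_ne_zero hn
  have := Real.log_le_log (clusterTail_pos hd hp hn) (hle n hn)
  rw [Real.log_mul hC.ne' (Real.exp_pos _).ne', Real.log_exp] at this
  rw [neg_mul, one_div_mul_eq_div, ← neg_div, le_div_iff₀ hn', sub_mul, div_mul_cancel₀ _ hn'.ne']
  linarith

end Connectivity

/-! ### Asymptotics of the largest cluster -/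

section LargestCluster

variable {d : ℕ} {p : unitInterval}

theorem measure_le_maxCluster_le {k : ℕ} (hk : k ≠ 0) (n : ℕ) :
    (bernoulliSite d p).real {ω | k ≤ maxCluster n ω} ≤ (2 * n + 1) ^ d * clusterTail d p k := by
  have hsub : {ω : Config d | k ≤ maxCluster n ω} ⊆ ⋃ x ∈ ball (0 : Site d) n, animalEvent x k := by
    intro ω hω
    obtain ⟨x, S, hS, hc, hy⟩ := (le_maxCluster_iff hk).1 hω
    simp only [Set.mem_iUnion]
    exact ⟨x, mem_ball_zero_iff.2 (hy x hS.root_mem).1, S, hS, hc, fun y h => (hy y h).2⟩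
  refine (measureReal_mono hsub (measure_ne_top _ _)).trans
    ((measureReal_biUnion_finset_le _ _).trans ?_)
  rw [Finset.sum_congr rfl fun x _ => (clusterTail_eq hk x).symm, Finset.sum_const, card_ball,
    nsmul_eq_mul]
  push_cast
  rfl

/-- Centres on the sublattice of mesh 2k+1 have disjoint balls of radius `k`, so (2m+1)^d
independent trials must all fail; then use 1 - t ≤ exp(-t). -/
theorem measure_maxCluster_lt_le {k m n : ℕ} (hk : k ≠ 0) (hmn : (2 * k + 1) * m + k ≤ n) :
    (bernoulliSite d p).real {ω | maxCluster n ω < k} ≤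
      Real.exp (-(clusterTail d p k * (2 * m + 1) ^ d)) := by
  set c : Site d → Site d := fun z i => (2 * k + 1) * z i
  have hsub : {ω : Config d | maxCluster n ω < k} ⊆
      ⋂ z ∈ ball (0 : Site d) m, (animalEvent (c z) k)ᶜ := by
    intro ω hω
    simp only [Set.mem_iInter]
    rintro z hz ⟨S, hS, hc, ho⟩
    refine absurd ((le_maxCluster_iff hk).2 ⟨c z, S, hS, hc, fun y hy => ⟨fun i => ?_, ho y hy⟩⟩)
      (not_le.2 hω)
    have h1 := mem_ball.1 (hS.subset_ball hy) i
    have h2 := mem_ball.1 hz i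
    have h3 : ((2 * k + 1) * m + k : ℤ) ≤ n := by exact_mod_cast hmn
    rw [hc] at h1
    simp only [c, Pi.zero_apply, sub_zero] at h1 h2
    have h4 : |(2 * k + 1) * z i| ≤ (2 * k + 1) * (m : ℤ) := by
      rw [abs_mul, abs_of_nonneg (by positivity : (0 : ℤ) ≤ 2 * k + 1)]
      exact mul_le_mul_of_nonneg_left h2 (by positivity)
    have h5 := abs_sub_abs_le_abs_sub (y i) ((2 * k + 1) * z i)
    linarith
  have hdis : Set.PairwiseDisjoint (ball (0 : Site d) m : Set (Site d)) fun z => ball (c z) k := by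
    intro z _ z' _ hne
    refine Finset.disjoint_left.2 fun w hw hw' => hne (funext fun i => ?_)
    have h1 := abs_le.1 (mem_ball.1 hw i)
    have h2 := abs_le.1 (mem_ball.1 hw' i)
    simp only [c] at h1 h2
    have h3 : (2 * k + 1) * (z i - z' i) < (2 * k + 1) * (1 : ℤ) := by linarith [h1.1, h2.2]
    have h4 : (2 * k + 1) * (z' i - z i) < (2 * k + 1) * (1 : ℤ) := by linarith [h1.2, h2.1]
    have h3' := lt_of_mul_lt_mul_left h3 (by positivity)
    have h4' := lt_of_mul_lt_mul_left h4 (by positivity)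
    omega
  refine (measureReal_mono hsub (measure_ne_top _ _)).trans ?_
  rw [measure_biInter_compl (fun z _ => eventOn_animalEvent (c z) k) hdis,
    Finset.prod_congr rfl fun z _ => by rw [← clusterTail_eq hk (c z)], Finset.prod_const,
    card_ball]
  refine (pow_le_pow_left₀ (sub_nonneg.2 (clusterTail_le_one k))
    (Real.one_sub_le_exp_neg _) _).trans ?_
  rw [← Real.exp_nat_mul]
  push_cast
  exact (congrArg Real.exp (by ring)).le

theorem ae_eventually_notMem_of_summable {Ω : Type*} [MeasurableSpace Ω] {μ : Measure Ω}
    [IsFiniteMeasure μ] {s : ℕ → Set Ω} {f : ℕ → ℝ} (hf : Summable f)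
    (h : ∀ᶠ j in atTop, μ.real (s j) ≤ f j) : ∀ᵐ ω ∂μ, ∀ᶠ j in atTop, ω ∉ s j := by
  refine ae_eventually_notMem ?_
  have hs : Summable fun j => μ.real (s j) := by
    refine Summable.of_norm_bounded_eventually_nat hf (h.mono fun j hj => ?_)
    rwa [Real.norm_of_nonneg measureReal_nonneg]
  have := hs.tsum_ofReal_ne_top
  simpa only [Measure.real, ENNReal.ofReal_toReal (measure_ne_top μ _)] using this

theorem tendsto_ceil_mul_log_two {b : ℝ} (hb : 0 < b) :
    Tendsto (fun j : ℕ => ⌈b * (j * Real.log 2)⌉₊) atTop atTop :=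
  tendsto_nat_ceil_atTop.comp ((tendsto_natCast_atTop_atTop.atTop_mul_const
    (Real.log_pos one_lt_two)).const_mul_atTop hb)

variable {ζ : ℝ}

theorem ae_eventually_maxCluster_lt (hd : 1 ≤ d) (hp : 0 < (p : ℝ)) (hζ : 0 < ζ)
    (hlim : Tendsto (fun n : ℕ => -(1 / (n : ℝ)) * Real.log (clusterTail d p n)) atTop (𝓝 ζ))
    {b : ℝ} (hb : d / ζ < b) :
    ∀ᵐ ω ∂(bernoulliSite d p), ∀ᶠ j : ℕ in atTop,
      (maxCluster (2 ^ j) ω : ℝ) < b * (j * Real.log 2) := by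
  have hb0 : 0 < b := (by positivity : 0 ≤ d / ζ).trans_lt hb
  have hdb : d / b < ζ := by rwa [div_lt_comm₀ hb0 hζ]
  -- With d/b < s < ζ, the union bound is of order 2^(jd) · 2^(-jsb), which is geometric since sb >
  -- d.
  obtain ⟨s, hs, hsζ⟩ := exists_between hdb
  have hs0 : 0 < s := (by positivity : 0 ≤ d / b).trans_lt hs
  rw [div_lt_iff₀ hb0] at hs
  have htail : ∀ᶠ k : ℕ in atTop, clusterTail d p k ≤ Real.exp (-(s * k)) := by
    filter_upwards [hlim.eventually (lt_mem_nhds hsζ), eventually_ne_atTop 0] with k hk hk0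
    have hk' : (0 : ℝ) < k := by exact_mod_cast Nat.pos_of_ne_zero hk0
    rw [← Real.log_le_iff_le_exp (clusterTail_pos hd hp hk0)]
    rw [neg_mul, one_div_mul_eq_div, ← neg_div, lt_div_iff₀ hk'] at hk
    linarith
  have hℓ := Real.log_pos one_lt_two
  have hk := tendsto_ceil_mul_log_two hb0
  have hsum : Summable fun j : ℕ => 3 ^ d * Real.exp (-((s * b - d) * Real.log 2)) ^ j :=
    (summable_geometric_of_lt_one (Real.exp_pos _).le (Real.exp_lt_one_iff.2
      (neg_neg_of_pos (mul_pos (by linarith) hℓ)))).mul_left _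
  have := ae_eventually_notMem_of_summable (μ := bernoulliSite d p)
    (s := fun j : ℕ => {ω | ⌈b * (j * Real.log 2)⌉₊ ≤ maxCluster (2 ^ j) ω}) hsum ?_
  · filter_upwards [this] with ω hω
    exact hω.mono fun j hj => Nat.lt_ceil.1 (not_le.1 hj)
  filter_upwards [hk.eventually htail, hk.eventually (eventually_ne_atTop 0)] with j hj hj0
  refine (measure_le_maxCluster_le hj0 _).trans ?_
  have h1 : clusterTail d p ⌈b * (j * Real.log 2)⌉₊ ≤ Real.exp (-(s * (b * (j * Real.log 2)))) :=
    hj.trans (Real.exp_le_exp.2 (neg_le_neg (mul_le_mul_of_nonneg_left (Nat.le_ceil _) hs0.le)))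
  have h2 : (2 * ((2 ^ j : ℕ) : ℝ) + 1) ^ d ≤ 3 ^ d * Real.exp (d * (j * Real.log 2)) := by
    rw [Real.exp_nat_mul, Real.exp_nat_mul, Real.exp_log two_pos, ← mul_pow]
    refine pow_le_pow_left₀ (by positivity) ?_ _
    have : (1 : ℝ) ≤ 2 ^ j := one_le_pow₀ one_le_two
    push_cast
    linarith
  refine (mul_le_mul h2 h1 measureReal_nonneg (by positivity)).trans (le_of_eq ?_)
  rw [← Real.exp_nat_mul, mul_assoc, ← Real.exp_add]
  congr 2
  ring

theorem exp_neg_le_inv {x : ℝ} (hx : 0 < x) : Real.exp (-x) ≤ x⁻¹ := by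
  rw [Real.exp_neg]
  exact inv_anti₀ hx (by linarith [Real.add_one_le_exp x])

theorem ae_eventually_le_maxCluster (hd : 1 ≤ d) (hp : 0 < (p : ℝ)) (hζ : 0 < ζ)
    (hlim : Tendsto (fun n : ℕ => -(1 / (n : ℝ)) * Real.log (clusterTail d p n)) atTop (𝓝 ζ))
    {b : ℝ} (hb0 : 0 < b) (hb : b < d / ζ) :
    ∀ᵐ ω ∂(bernoulliSite d p), ∀ᶠ j : ℕ in atTop,
      b * (j * Real.log 2) ≤ maxCluster (2 ^ j) ω := by
  have hdb : ζ < d / b := by rwa [lt_div_comm₀ hζ hb0]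
  -- With sb < d, the expected number of successful trials grows like 2^(j(d-sb)) up to powers of j.
  -- The crude bound exp(-x) ≤ 1/x is therefore already summable.
  obtain ⟨s, hζs, hs⟩ := exists_between hdb
  have hs0 : 0 < s := hζ.trans hζs
  rw [lt_div_iff₀ hb0] at hs
  have htail : ∀ᶠ k : ℕ in atTop, Real.exp (-(s * k)) ≤ clusterTail d p k := by
    filter_upwards [hlim.eventually (gt_mem_nhds hζs), eventually_ne_atTop 0] with k hk hk0
    have hk' : (0 : ℝ) < k := by exact_mod_cast Nat.pos_of_ne_zero hk0
    rw [← Real.le_log_iff_exp_le (clusterTail_pos hd hp hk0)]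
    rw [neg_mul, one_div_mul_eq_div, ← neg_div, div_lt_iff₀ hk'] at hk
    linarith
  have hℓ := Real.log_pos one_lt_two
  have hk := tendsto_ceil_mul_log_two hb0
  set B := b * Real.log 2
  have hB : 0 < B := mul_pos hb0 hℓ
  have hsum : Summable fun j : ℕ => Real.exp s * (2 * B + 3) ^ d *
      ((j : ℝ) ^ d * Real.exp (-((d - s * b) * Real.log 2)) ^ j) := by
    have hr : ‖Real.exp (-((d - s * b) * Real.log 2))‖ < 1 := by
      rw [Real.norm_of_nonneg (Real.exp_pos _).le]
      exact Real.exp_lt_one_iff.2 (neg_neg_of_pos (mul_pos (by linarith) hℓ))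
    exact Summable.mul_left _ (summable_pow_mul_geometric_of_norm_lt_one d hr)
  have := ae_eventually_notMem_of_summable (μ := bernoulliSite d p)
    (s := fun j : ℕ => {ω | maxCluster (2 ^ j) ω < ⌈b * (j * Real.log 2)⌉₊}) hsum ?_
  · filter_upwards [this] with ω hω
    exact hω.mono fun j hj => Nat.ceil_le.1 (not_lt.1 hj)
  have hpow : ∀ᶠ j : ℕ in atTop, 4 * (B + 1) * j ≤ (2 : ℝ) ^ j := by
    have := (tendsto_pow_const_div_const_pow_of_one_lt 1 (one_lt_two (α := ℝ))).eventually
      (gt_mem_nhds (show 0 < 1 / (4 * (B + 1)) by positivity))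
    filter_upwards [this] with j hj
    rw [pow_one, div_lt_div_iff₀ (by positivity) (by positivity)] at hj
    linarith
  filter_upwards [hk.eventually htail, hk.eventually (eventually_ne_atTop 0), hpow,
    eventually_ge_atTop 1] with j hj hj0 hjpow hj1
  have hj1' : (1 : ℝ) ≤ j := by exact_mod_cast hj1
  set k := ⌈b * (j * Real.log 2)⌉₊
  have hkle : (k : ℝ) ≤ B * j + 1 := by
    have := (Nat.ceil_lt_add_one (show 0 ≤ b * (j * Real.log 2) by positivity)).le
    refine this.trans (le_of_eq ?_)
    simp only [B]
    ring
  have hk4 : 4 * k ≤ 2 ^ j := by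
    have : (4 * k : ℝ) ≤ 2 ^ j := by nlinarith
    exact_mod_cast this
  -- The largest grid of balls fitting in the box. The bound `hk4` absorbs the rounding, so that
  -- (2k+1)(2m+1) ≥ 2^j.
  set m := (2 ^ j - k) / (2 * k + 1)
  have hm : (2 * k + 1) * m + k ≤ 2 ^ j := by
    have := Nat.mul_div_le (2 ^ j - k) (2 * k + 1)
    simp only [m]
    omega
  have hm' : (2 : ℝ) ^ j ≤ (2 * k + 1) * (2 * m + 1) := by
    have h1 := Nat.div_add_mod (2 ^ j - k) (2 * k + 1)
    have h2 := Nat.mod_lt (2 ^ j - k) (show 0 < 2 * k + 1 by omega)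
    have h3 : 2 ^ j ≤ (2 * k + 1) * m + (2 * k + 1) * m + (2 * k + 1) := by
      simp only [m]
      omega
    have h4 : 2 ^ j ≤ (2 * k + 1) * (2 * m + 1) := by linarith
    exact_mod_cast h4
  refine (measure_maxCluster_lt_le hj0 hm).trans ?_
  have hu := clusterTail_pos hd hp hj0
  refine (exp_neg_le_inv (by positivity)).trans ?_
  rw [inv_le_iff_one_le_mul₀ (by positivity)]
  have h2k : (2 * k + 1 : ℝ) ≤ (2 * B + 3) * j := by nlinarith
  have hpd : Real.exp (d * (j * Real.log 2)) ≤ ((2 * B + 3) * j) ^ d * (2 * m + 1) ^ d := by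
    rw [Real.exp_nat_mul, Real.exp_nat_mul, Real.exp_log two_pos, ← mul_pow]
    exact pow_le_pow_left₀ (by positivity)
      (hm'.trans (mul_le_mul_of_nonneg_right h2k (by positivity))) _
  -- The factor exp(s) pays for rounding `k` up by at most 1.
  have hue : Real.exp (-(s * (b * (j * Real.log 2)))) ≤ Real.exp s * clusterTail d p k := by
    refine le_trans ?_ (mul_le_mul_of_nonneg_left hj (Real.exp_pos _).le)
    rw [← Real.exp_add, Real.exp_le_exp]
    have : (k : ℝ) ≤ b * (j * Real.log 2) + 1 :=
      (Nat.ceil_lt_add_one (show 0 ≤ b * (j * Real.log 2) by positivity)).le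
    nlinarith
  have hone : 1 = Real.exp (d * (j * Real.log 2)) * Real.exp (-(s * (b * (j * Real.log 2)))) *
      Real.exp (-((d - s * b) * Real.log 2)) ^ j := by
    rw [← Real.exp_nat_mul, ← Real.exp_add, ← Real.exp_add, eq_comm, Real.exp_eq_one_iff]
    ring
  calc (1 : ℝ) = _ := hone
    _ ≤ (((2 * B + 3) * j) ^ d * (2 * m + 1) ^ d) * (Real.exp s * clusterTail d p k) *
        Real.exp (-((d - s * b) * Real.log 2)) ^ j := by gcongr
    _ = _ := by rw [mul_pow]; ring

/-- Sandwich `n` between consecutive powers of 2; their logarithms have ratio tending to 1. -/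
theorem tendsto_div_log_of_tendsto_two_pow {f : ℕ → ℕ} (hf : Monotone f) {L : ℝ}
    (h : Tendsto (fun j : ℕ => (f (2 ^ j) : ℝ) / (j * Real.log 2)) atTop (𝓝 L)) :
    Tendsto (fun n : ℕ => (f n : ℝ) / Real.log n) atTop (𝓝 L) := by
  have hℓ := Real.log_pos one_lt_two
  have hlog : Tendsto (fun n => Nat.log 2 n) atTop atTop := by
    refine tendsto_atTop.2 fun j => ?_
    filter_upwards [eventually_ge_atTop (2 ^ j)] with n hn
    exact Nat.le_log_of_pow_le one_lt_two hn
  have hr : Tendsto (fun j : ℕ => (j : ℝ) / (j + 1)) atTop (𝓝 1) :=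
    tendsto_natCast_div_add_atTop 1
  have hlow : Tendsto (fun j : ℕ => (f (2 ^ j) : ℝ) / ((j + 1) * Real.log 2)) atTop (𝓝 L) := by
    have := h.mul hr
    rw [mul_one] at this
    refine this.congr' ?_
    filter_upwards [eventually_ne_atTop 0] with j hj
    have : (j : ℝ) ≠ 0 := by exact_mod_cast hj
    field_simp
  have hup : Tendsto (fun j : ℕ => (f (2 ^ (j + 1)) : ℝ) / (j * Real.log 2)) atTop (𝓝 L) := by
    have := (h.comp (tendsto_add_atTop_nat 1)).div hr one_ne_zero
    rw [div_one] at this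
    refine this.congr' ?_
    filter_upwards [eventually_ne_atTop 0] with j hj
    have : (j : ℝ) ≠ 0 := by exact_mod_cast hj
    simp only [Pi.div_apply, Function.comp_apply]
    push_cast
    field_simp
  refine tendsto_of_tendsto_of_tendsto_of_le_of_le' (hlow.comp hlog) (hup.comp hlog) ?_ ?_
  · filter_upwards [eventually_ge_atTop 2] with n hn
    have hn0 : (0 : ℝ) < n := by exact_mod_cast (by omega : 0 < n)
    have h1 : f (2 ^ Nat.log 2 n) ≤ f n := hf (Nat.pow_log_le_self 2 (by omega))
    have h2 : Real.log n ≤ (Nat.log 2 n + 1) * Real.log 2 := by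
      have : (n : ℝ) ≤ 2 ^ (Nat.log 2 n + 1) := by
        exact_mod_cast (Nat.lt_pow_succ_log_self one_lt_two n).le
      have := Real.log_le_log hn0 this
      rw [Real.log_pow] at this
      exact_mod_cast this
    have h3 : 0 < Real.log n := Real.log_pos (by exact_mod_cast (by omega : 1 < n))
    exact div_le_div₀ (Nat.cast_nonneg _) (by exact_mod_cast h1) h3 h2
  · filter_upwards [eventually_ge_atTop 2] with n hn
    have h1 : f n ≤ f (2 ^ (Nat.log 2 n + 1)) := hf (Nat.lt_pow_succ_log_self one_lt_two n).le
    have h2 : Nat.log 2 n * Real.log 2 ≤ Real.log n := by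
      have : (2 : ℝ) ^ Nat.log 2 n ≤ n := by exact_mod_cast Nat.pow_log_le_self 2 (by omega)
      have := Real.log_le_log (by positivity) this
      rwa [Real.log_pow] at this
    have h3 : (0 : ℝ) < Nat.log 2 n := by exact_mod_cast Nat.log_pos one_lt_two hn
    exact div_le_div₀ (Nat.cast_nonneg _) (by exact_mod_cast h1) (by positivity) h2

theorem ae_tendsto_maxCluster_div_log (hd : 1 ≤ d) (hp : 0 < (p : ℝ)) (hζ : 0 < ζ)
    (hlim : Tendsto (fun n : ℕ => -(1 / (n : ℝ)) * Real.log (clusterTail d p n)) atTop (𝓝 ζ)) :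
    ∀ᵐ ω ∂(bernoulliSite d p),
      Tendsto (fun n : ℕ => (maxCluster n ω : ℝ) / Real.log n) atTop (𝓝 ((d : ℝ) / ζ)) := by
  have hd' : (0 : ℝ) < d := by exact_mod_cast hd
  -- Countably many thresholds on each side of d/ζ, so that a single null set serves them all.
  obtain ⟨u, -, hu, hulim⟩ := exists_seq_strictMono_tendsto' (div_pos hd' hζ)
  obtain ⟨v, -, hv, hvlim⟩ := exists_seq_strictAnti_tendsto ((d : ℝ) / ζ)
  filter_upwards [ae_all_iff.2 fun i => ae_eventually_le_maxCluster hd hp hζ hlim (hu i).1 (hu i).2,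
    ae_all_iff.2 fun i => ae_eventually_maxCluster_lt hd hp hζ hlim (hv i)] with ω hlow hup
  refine tendsto_div_log_of_tendsto_two_pow (maxCluster_mono ω) (tendsto_order.2 ⟨?_, ?_⟩)
  · intro a ha
    obtain ⟨i, hi⟩ := (hulim.eventually (lt_mem_nhds ha)).exists
    filter_upwards [hlow i, eventually_ge_atTop 1] with j hj hj1
    have : 0 < (j : ℝ) * Real.log 2 := mul_pos (by exact_mod_cast hj1) (Real.log_pos one_lt_two)
    exact hi.trans_le ((le_div_iff₀ this).2 hj)
  · intro a ha
    obtain ⟨i, hi⟩ := (hvlim.eventually (gt_mem_nhds ha)).exists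
    filter_upwards [hup i, eventually_ge_atTop 1] with j hj hj1
    have : 0 < (j : ℝ) * Real.log 2 := mul_pos (by exact_mod_cast hj1) (Real.log_pos one_lt_two)
    exact ((div_lt_iff₀ this).2 hj).trans hi

end LargestCluster

end SitePercolation

theorem theorem1p3 (d : ℕ) (hd : 1 ≤ d) (p : unitInterval) (hp₀ : 0 < (p : ℝ))
    (hp : (p : ℝ) < SitePercolation.criticalValue d) :
    ∃ ζ : ℝ, 0 < ζ ∧
      Tendsto (fun n : ℕ => -(1 / (n : ℝ)) * Real.log (SitePercolation.clusterTail d p n))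
        atTop (𝓝 ζ) ∧
      ∀ᵐ ω ∂(SitePercolation.bernoulliSite d p),
        Tendsto (fun n : ℕ => (SitePercolation.maxCluster n ω : ℝ) / Real.log n)
          atTop (𝓝 ((d : ℝ) / ζ)) := by
  obtain ⟨ζ, hζ, hlim⟩ := SitePercolation.exists_pos_tendsto_log_clusterTail hd hp₀ hp
  exact ⟨ζ, hζ, hlim, SitePercolation.ae_tendsto_maxCluster_div_log hd hp₀ hζ hlim⟩
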